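/- Let $d\ge 1$, $s_0>0$, $|x|=\max_i|x_i|$ on $\mathbb{R}^d$ and $\|(t,x)\|_{\mathfrak s}=|t|^{1/s_0}\vee|x|$. Let $\xi$ be Gaussian white noise on $\mathbb{R}^{1+d}$ over a probability space (a centred Gaussian family $(\xi(h))_{h\in L^2(\mathbb{R}^{1+d})}$ with $\mathbb{E}[\xi(g)\xi(h)]=\langle g,h\rangle$), and let $I_k:L^2(\mathbb{R}^{1+d})^{\otimes k}\to L^2(\mathbb{P})$ be the $k$-fold multiple Wiener integral: the continuous linear map that sends the indicator function of $A_1\times\dots\times A_k$ to $\prod_i\xi(\mathbf 1_{A_i})$ for pairwise disjoint measurable sets $A_i$ of finite measure. Let $S_x^{\otimes k}$ be the spatial translation $(S_x^{\otimes k}f)(z_1,\dots,z_k)=f(z_1-(0,x),\dots,z_k-(0,x))$. Let $\tau$ be a symbol with homogeneity $|\tau|\in\mathbb{R}$ and with $m\in\mathbb{N}_0$ occurrences of the noise, and let $J\subset\mathbb{R}$ be a set of times. For $1\le k\le m$, $t\in J$, $x\in\mathbb{R}^d$ and $\varepsilon\in(0,1]$ let $(\mathcal{W}^{(k)}\tau)(t,x)$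 and $(\mathcal{W}^{(k;\varepsilon)}\tau)(t,x)$ be elements of $L^2(\mathbb{R}^{1+d})^{\otimes k}$, measurable in $x$; put $\delta\mathcal{W}^{(k;\varepsilon)}=\mathcal{W}^{(k;\varepsilon)}-\mathcal{W}^{(k)}$. For a continuous, compactly supported $\varphi:\mathbb{R}^d\to\mathbb{R}$ set $$(\Pi_x^t\tau,\varphi)=\sum_{k=1}^m I_k\Big(\int_{\mathbb{R}^d}\varphi(y)\,S_x^{\otimes k}(\mathcal{W}^{(k)}\tau)(t,y-x)\,dy\Big),$$ with a weak (Pettis) integral in $L^2(\mathbb{R}^{1+d})^{\otimes k}$, and define $\hat\Pi_x^{\varepsilon,t}\tau$ in the same way with $\mathcal{W}^{(k;\varepsilon)}$. For $r\in\mathbb{N}$, $r\geq 1$, let $\mathcal{B}_r$ be the set of $\varphi\in C^r(\mathbb{R}^d)$ with support in the closed unit ball and all partial derivatives of order at most $r$ bounded by $1$ in absolute value, and put $\varphi_x^\lambda(y)=\lambda^{-d}\varphi(\lambda^{-1}(y-x))$. **(a)** Suppose there are $\nu,\nu',C>0$ with $2(|\tau|+\nu)>-d$ and finitely many $\zeta\in[0,2(|\tau|+\nu)+d)$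 such that for all $1\le k\le m$, $\varepsilon\in(0,1]$, $t\in J$ and $x\ne\bar x$ in $\mathbb{R}^d$ $$|\langle(\mathcal{W}^{(k)}\tau)(t,x),(\mathcal{W}^{(k)}\tau)(t,\bar x)\rangle|\le C\sum_\zeta(|x|+|\bar x|)^\zeta|x-\bar x|^{2(|\tau|+\nu)-\zeta},$$ $$|\langle(\delta\mathcal{W}^{(k;\varepsilon)}\tau)(t,x),(\delta\mathcal{W}^{(k;\varepsilon)}\tau)(t,\bar x)\rangle|\le C\varepsilon^{\nu'}\sum_\zeta(|x|+|\bar x|)^\zeta|x-\bar x|^{2(|\tau|+\nu)-\zeta}.$$ Then the integrals that define $\Pi_x^t\tau$ and $\hat\Pi_x^{\varepsilon,t}\tau$ exist, and for every integer $r\ge1$ there is a constant $C'$ such that, for all $\varepsilon,\lambda\in(0,1]$, $\varphi\in\mathcal{B}_r$, $x\in\mathbb{R}^d$ and $t\in J$, $$\mathbb{E}|(\Pi_x^t\tau,\varphi_x^\lambda)|^2\le C'\lambda^{2(|\tau|+\nu)},\qquad \mathbb{E}|(\hat\Pi_x^{\varepsilon,t}\tau-\Pi_x^t\tau,\varphi_x^\lambda)|^2\le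 C'\varepsilon^{\nu'}\lambda^{2(|\tau|+\nu)}.$$ **(b)** Suppose in addition that for some $\delta\in(0,|\tau|+\nu+d/2)$, some $K>0$ and finitely many $\zeta\in[0,2(|\tau|+\nu-\delta)+d)$, for all $1\le k\le m$, $\varepsilon\in(0,1]$, $s,t\in J$ and $x\ne\bar x$, the quantities $$|\langle(\mathcal{W}^{(k)}\tau)(t,x)-(\mathcal{W}^{(k)}\tau)(s,x),(\mathcal{W}^{(k)}\tau)(t,\bar x)-(\mathcal{W}^{(k)}\tau)(s,\bar x)\rangle|$$ and $$\varepsilon^{-\nu'}|\langle(\delta\mathcal{W}^{(k;\varepsilon)}\tau)(t,x)-(\delta\mathcal{W}^{(k;\varepsilon)}\tau)(s,x),(\delta\mathcal{W}^{(k;\varepsilon)}\tau)(t,\bar x)-(\delta\mathcal{W}^{(k;\varepsilon)}\tau)(s,\bar x)\rangle|$$ are bounded by $$K\sum_\zeta(\|(t-s,x)\|_{\mathfrak s}+\|(t-s,\bar x)\|_{\mathfrak s})^\zeta|x-\bar x|^{2(|\tau|+\nu-\delta)-\zeta}|t-s|^{2\delta/s_0}.$$ Then for every integer $r\ge1$ there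 is a constant $C''$ such that, for all $\varepsilon,\lambda\in(0,1]$, $\varphi\in\mathcal{B}_r$, $x\in\mathbb{R}^d$ and $s,t\in J$, $$\mathbb{E}|(\Pi_x^t\tau-\Pi_x^s\tau,\varphi_x^\lambda)|^2\le C''\lambda^{2(|\tau|+\nu-\delta)}|t-s|^{2\delta/s_0},$$ $$\mathbb{E}|(\hat\Pi_x^{\varepsilon,t}\tau-\Pi_x^t\tau-\hat\Pi_x^{\varepsilon,s}\tau+\Pi_x^s\tau,\varphi_x^\lambda)|^2\le C''\varepsilon^{\nu'}\lambda^{2(|\tau|+\nu-\delta)}|t-s|^{2\delta/s_0}.$$ -/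

import Mathlib

open MeasureTheory ProbabilityTheory

noncomputable section

/-! ### Space, time and test functions -/

/-- `ℝ^{1+d}`, a point being a pair (time, space).  The norm of `Fin d → ℝ` is the supremum norm. -/
abbrev SpaceTime (d : ℕ) : Type := ℝ × (Fin d → ℝ)

/-- The scaled norm `‖(t,x)‖_𝔰 = |t|^{1/s₀} ∨ |x|` for the scaling `𝔰 = (s₀, 1, …, 1)`. -/
def scaledNorm {d : ℕ} (s₀ : ℝ) (t : ℝ) (x : Fin d → ℝ) : ℝ :=
  max (|t| ^ (1 / s₀)) ‖x‖

/-- The class `𝓑_r`: functions of class `C^r` with support in the unit ball, all of whose partial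
derivatives of order at most `r` are bounded by one in absolute value. -/
def TestClass (d r : ℕ) : Set ((Fin d → ℝ) → ℝ) :=
  {φ | ContDiff ℝ (r : WithTop ℕ∞) φ ∧ tsupport φ ⊆ Metric.closedBall 0 1 ∧
    ∀ n ≤ r, ∀ j : Fin n → Fin d, ∀ y,
      |iteratedFDeriv ℝ n φ y (fun i => Pi.single (j i) 1)| ≤ 1}

/-- The scaled test function `φ_x^l (y) = l^{-d} φ (l⁻¹ (y - x))`. -/
def scaledTest {d : ℕ} (φ : (Fin d → ℝ) → ℝ) (l : ℝ) (x : Fin d → ℝ) : (Fin d → ℝ) → ℝ :=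
  fun y => (l ^ d)⁻¹ * φ (l⁻¹ • (y - x))

/-! ### Weak (Pettis) integrals in a Hilbert space -/

/-- `F` is the weak integral of the Hilbert space valued function `f`:
`⟪F, g⟫ = ∫ ⟪f y, g⟫ dy` for all `g`, the right-hand side being absolutely convergent. -/
def IsWeakIntegral {X H : Type*} [MeasurableSpace X] (μ : Measure X)
    [NormedAddCommGroup H] [InnerProductSpace ℝ H] (f : X → H) (F : H) : Prop :=
  ∀ g : H, Integrable (fun y => inner ℝ (f y) g) μ ∧
    inner ℝ F g = ∫ y, inner ℝ (f y) g ∂μ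

open Classical in
/-- The weak integral of `f` (it is unique when it exists; zero when it does not exist). -/
def weakIntegral {X H : Type*} [MeasurableSpace X] (μ : Measure X)
    [NormedAddCommGroup H] [InnerProductSpace ℝ H] (f : X → H) : H :=
  if h : ∃ F, IsWeakIntegral μ f F then h.choose else 0

/-! ### White noise and multiple Wiener integrals -/

/-- The space `L²(ℝ^{1+d})^{⊗k}`, realised as `L²((ℝ^{1+d})^k)`. -/
abbrev KernelSpace (d k : ℕ) : Type :=
  Lp ℝ 2 (volume : Measure (Fin k → SpaceTime d))

/-- Gaussian white noise on `ℝ^{1+d}`, extended to all of `L²(ℝ^{1+d})`: a centred Gaussian family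
`ξ h`, `h ∈ L²(ℝ^{1+d})`, with `E[ξ g · ξ h] = ⟪g, h⟫`. -/
structure IsWhiteNoise {d : ℕ} {Ω : Type*} [MeasurableSpace Ω] (P : Measure Ω)
    (ξ : Lp ℝ 2 (volume : Measure (SpaceTime d)) → Ω → ℝ) : Prop where
  gaussian : IsGaussianProcess ξ P
  centred : ∀ h, ∫ ω, ξ h ω ∂P = 0
  covariance : ∀ g h, ∫ ω, ξ g ω * ξ h ω ∂P = inner ℝ g h

/-- The `k`-fold integrals of the simplest off-diagonal functions: for pairwise disjoint measurable
sets `A₁, …, A_k` of finite measure, the indicator function of `A₁ × ⋯ × A_k` is paired with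
`ξ(A₁) ⋯ ξ(A_k)`. -/
def elementaryPairs {d : ℕ} {Ω : Type*} [MeasurableSpace Ω] (P : Measure Ω)
    (ξ : Lp ℝ 2 (volume : Measure (SpaceTime d)) → Ω → ℝ) (k : ℕ) :
    Set (KernelSpace d k × Lp ℝ 2 P) :=
  {p | ∃ (A : Fin k → Set (SpaceTime d)) (hA : ∀ i, MeasurableSet (A i))
      (hfin : ∀ i, volume (A i) ≠ ⊤),
      (∀ i j, i ≠ j → Disjoint (A i) (A j)) ∧
      (p.1 =ᵐ[volume] (Set.univ.pi A).indicator (fun _ => (1 : ℝ))) ∧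
      (p.2 =ᵐ[P] fun ω => ∏ i, ξ (indicatorConstLp 2 (hA i) (hfin i) (1 : ℝ)) ω)}

/-- The graph of the `k`-fold multiple Wiener integral: the `L²`-closure of the graph of its linear
extension to off-diagonal elementary functions. -/
def wienerGraph {d : ℕ} {Ω : Type*} [MeasurableSpace Ω] (P : Measure Ω)
    (ξ : Lp ℝ 2 (volume : Measure (SpaceTime d)) → Ω → ℝ) (k : ℕ) :
    Submodule ℝ (KernelSpace d k × Lp ℝ 2 P) :=
  (Submodule.span ℝ (elementaryPairs P ξ k)).topologicalClosure

open Classical in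
/-- The multiple Wiener integral `I_k(f) ∈ L²(P)` of `f ∈ L²(ℝ^{1+d})^{⊗k}`: the extension by
`L²`-continuity of the integral of off-diagonal elementary functions. For white noise `ξ`, the `Y`
below exists and is unique for every `f`. -/
def wienerIntegral {d : ℕ} {Ω : Type*} [MeasurableSpace Ω] (P : Measure Ω)
    (ξ : Lp ℝ 2 (volume : Measure (SpaceTime d)) → Ω → ℝ) (k : ℕ) (f : KernelSpace d k) :
    Lp ℝ 2 P :=
  if h : ∃ Y, (f, Y) ∈ wienerGraph P ξ k then h.choose else 0

/-! ### The random distributions `Π_x^t τ` -/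

theorem measurePreserving_translate (d k : ℕ) (x : Fin d → ℝ) :
    MeasurePreserving (fun (z : Fin k → SpaceTime d) (i : Fin k) => z i - ((0 : ℝ), x))
      volume volume := by
  have h : (volume : Measure (SpaceTime d)).IsAddHaarMeasure := by
    rw [Measure.volume_eq_prod]; infer_instance
  exact volume_preserving_pi fun _ => measurePreserving_sub_right volume ((0 : ℝ), x)

/-- The spatial translation `S_x^{⊗k}` on `L²(ℝ^{1+d})^{⊗k}`:
`(S_x^{⊗k} f)(z₁, …, z_k) = f(z₁ - (0,x), …, z_k - (0,x))`. -/
def translateKernel {d k : ℕ} (x : Fin d → ℝ) (f : KernelSpace d k) : KernelSpace d k :=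
  Lp.compMeasurePreserving (fun (z : Fin k → SpaceTime d) (i : Fin k) => z i - ((0 : ℝ), x))
    (measurePreserving_translate d k x) f

/-- The integrand `y ↦ φ(y) S_x^{⊗k} W(t, y - x)`: the kernel `W` and its noise variables are
translated together, so that the base point `0` is moved to `x`. -/
def smearedKernel {d k : ℕ} (W : ℝ → (Fin d → ℝ) → KernelSpace d k) (t : ℝ) (x : Fin d → ℝ)
    (φ : (Fin d → ℝ) → ℝ) : (Fin d → ℝ) → KernelSpace d k :=
  fun y => φ y • translateKernel x (W t (y - x))

/-- `(Π_x^t τ)(φ) = ∑_{1 ≤ k ≤ m} I_k (∫ φ(y) S_x^{⊗k} W^{(k)}(t, y - x) dy)`. -/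
def chaosModel {d : ℕ} {Ω : Type*} [MeasurableSpace Ω] (P : Measure Ω)
    (ξ : Lp ℝ 2 (volume : Measure (SpaceTime d)) → Ω → ℝ) (m : ℕ)
    (W : (k : ℕ) → ℝ → (Fin d → ℝ) → KernelSpace d k)
    (t : ℝ) (x : Fin d → ℝ) (φ : (Fin d → ℝ) → ℝ) : Lp ℝ 2 P :=
  ∑ k ∈ Finset.Icc 1 m,
    wienerIntegral P ξ k (weakIntegral volume (smearedKernel (W k) t x φ))

end

/-!
Multiple Wiener integrals are bounded in `L²`, so the second moment of each random distribution is
controlled by the squared `L²` norms of its smeared kernels, and such a norm is a double integral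
of the covariance of the kernels against the test function. The theorem is thus a deterministic
estimate together with two existence facts, for Wiener integrals and for weak integrals.

* The Wiener integral is bounded and everywhere defined. For products over disjoint sets, the two
  families of sets are refined to common cells, on which the noises are independent; only complete
  pairings survive in the expectation (`integral_prod_sum_mul_prod_sum`), so that the covariance
  is a sum over permutations (`inner_snd_eq_of_mem_span`). Hence `‖I_k f‖² ≤ k! ‖f‖²` on the whole
  graph. Off-diagonal elementary functions are dense since diagonals are null and off the diagonals
  products of disjoint sets form a generating π-system
  (`eq_zero_of_forall_setIntegral_pi_eq_zero`).
* The kernels are controlled only off the diagonal, so the smeared kernel need not be Bochner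
  integrable. Integrability of the covariance `⟪f y, f y'⟫` suffices for the weak integral `F` to
  exist, with `‖F‖² ≤ ∬ |⟪f y, f y'⟫|` (`exists_isWeakIntegral`).
* A singularity `‖y - y'‖ ^ (q - ζ)` with `q - ζ > -d` is integrable, and on a ball of radius `l`
  its double integral scales as `l ^ (2 * d + q - ζ)`; the weights contribute `l ^ ζ` and the test
  functions `l ^ (-2 * d)`, which leaves `l ^ q` (`norm_sq_le_of_isWeakIntegral_scaledTest`).

For time increments, the hypothesis on increments scales in the same way as long as
`|t - s| ^ (1 / s₀) ≤ l`. For larger `|t - s|` the bounds at fixed times are already good enough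
(`norm_sub_sq_le_of_isWeakIntegral_scaledTest`).
-/

noncomputable section

/-! ### Moments of products of independent centred variables -/

/-- The mean of a product of independent variables with repetitions: `c x` is the variable that
serves as the factor `x`. -/
theorem integral_prod_comp_eq_prod_integral_pow {Ω E X : Type*} [MeasurableSpace Ω]
    {P : Measure Ω} [Fintype E] [DecidableEq E] [Fintype X] {G : E → Ω → ℝ}
    (hG : iIndepFun G P) (mG : ∀ e, AEMeasurable (G e) P) (c : X → E) :
    ∫ ω, ∏ x, G (c x) ω ∂P
      = ∏ e, ∫ ω, G e ω ^ (Finset.univ.filter fun x => c x = e).card ∂P := by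
  have h : ∀ ω, ∏ x, G (c x) ω
      = ∏ e, G e ω ^ (Finset.univ.filter fun x => c x = e).card := by
    intro ω
    rw [← Finset.prod_fiberwise Finset.univ c]
    refine Finset.prod_congr rfl fun e _ => ?_
    rw [Finset.prod_congr rfl (g := fun _ => G e ω), Finset.prod_const]
    intro x hx
    rw [(Finset.mem_filter.1 hx).2]
  simp_rw [h]
  exact hG.integral_fun_prod_comp
    (f := fun e y => y ^ (Finset.univ.filter fun x => c x = e).card) mG
    fun e => (continuous_pow _).aestronglyMeasurable

/-- If one factor of a product of independent centred variables, taken with repetitions, occurs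
exactly once, then the product has mean zero. -/
theorem integral_prod_comp_eq_zero {Ω E X : Type*} [MeasurableSpace Ω]
    {P : Measure Ω} [Fintype E] [DecidableEq E] [Fintype X] {G : E → Ω → ℝ}
    (hG : iIndepFun G P) (mG : ∀ e, AEMeasurable (G e) P) (c : X → E) (x₀ : X)
    (h₀ : ∀ x, c x = c x₀ → x = x₀) (hc : ∫ ω, G (c x₀) ω ∂P = 0) :
    ∫ ω, ∏ x, G (c x) ω ∂P = 0 := by
  rw [integral_prod_comp_eq_prod_integral_pow hG mG]
  refine Finset.prod_eq_zero (Finset.mem_univ (c x₀)) ?_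
  have : (Finset.univ.filter fun x => c x = c x₀) = {x₀} := by
    ext x
    simp only [Finset.mem_filter, Finset.mem_univ, true_and, Finset.mem_singleton]
    exact ⟨h₀ x, fun h => h ▸ rfl⟩
  simpa [this] using hc

/-- For an independent centred array `G`, the mean of one entry from each row `some i` times one
entry from each column `some j` vanishes unless both choices trace the graph of the same
permutation. -/
theorem integral_prod_mul_prod_eq_sum_perm {Ω ι : Type*} [MeasurableSpace Ω]
    {P : Measure Ω} [Fintype ι] [DecidableEq ι] {G : Option ι × Option ι → Ω → ℝ}
    (hG : iIndepFun G P) (mG : ∀ e, AEMeasurable (G e) P) (cG : ∀ e, ∫ ω, G e ω ∂P = 0)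
    (a b : ι → Option ι) :
    ∫ ω, (∏ i, G (some i, a i) ω) * ∏ j, G (b j, some j) ω ∂P
      = ∑ σ : Equiv.Perm ι, if a = (fun i => some (σ i)) then
          if b = (fun j => some (σ.symm j)) then
            ∏ i, ∫ ω, G (some i, some (σ i)) ω ^ 2 ∂P else 0 else 0 := by
  -- If the choices do not match a permutation, the entry in some row occurs exactly once.
  by_cases hσ : ∃ σ : Equiv.Perm ι, a = (fun i => some (σ i)) ∧ b = fun j => some (σ.symm j)
  · obtain ⟨σ, rfl, rfl⟩ := hσ
    rw [Finset.sum_eq_single σ]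
    · simp only [if_true]
      have h : ∀ ω, (∏ i, G (some i, some (σ i)) ω) * ∏ j, G (some (σ.symm j), some j) ω
          = ∏ i, G (some i, some (σ i)) ω ^ 2 := by
        intro ω
        rw [← Equiv.prod_comp σ (fun j => G (some (σ.symm j), some j) ω),
          ← Finset.prod_mul_distrib]
        refine Finset.prod_congr rfl fun i _ => ?_
        simp [sq]
      simp_rw [h]
      have hinj : Function.Injective fun i : ι => ((some i, some (σ i)) : Option ι × Option ι) := by
        intro i i' h
        simpa using congrArg Prod.fst h
      exact (hG.precomp hinj).integral_fun_prod_comp (f := fun _ y => y ^ 2)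
        (fun i => mG _) fun _ => (continuous_pow 2).aestronglyMeasurable
    · intro τ _ hτ
      rw [if_neg]
      intro h
      apply hτ
      ext i
      simpa using (congrFun h i).symm
    · simp
  · rw [Finset.sum_eq_zero]
    · have hex : ∃ i, ∀ j, a i = some j → b j ≠ some i := by
        by_contra! hcon
        choose s hs1 hs2 using hcon
        have hs : Function.Injective s := by
          intro i i' h
          have := hs2 i
          rw [h, hs2 i'] at this
          simpa using this.symm
        refine hσ ⟨Equiv.ofBijective s (Finite.injective_iff_bijective.1 hs), ?_, ?_⟩
        · ext1 i
          simpa using hs1 i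
        · ext1 j
          obtain ⟨i, rfl⟩ := (Finite.injective_iff_bijective.1 hs).2 j
          rw [hs2 i]
          congr 1
          exact ((Equiv.ofBijective s (Finite.injective_iff_bijective.1 hs)).symm_apply_apply
            i).symm
      obtain ⟨i, hi⟩ := hex
      have h := integral_prod_comp_eq_zero hG mG
        (Sum.elim (fun i => (some i, a i)) fun j => (b j, some j)) (Sum.inl i) ?_ (cG _)
      · simpa [Fintype.prod_sum_type] using h
      · rintro (i' | j) h
        · simpa using congrArg Prod.fst h
        · simp only [Sum.elim_inr, Sum.elim_inl, Prod.mk.injEq] at h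
          exact absurd h.1 (hi j h.2.symm)
    · intro τ _
      by_cases h1 : a = fun i => some (τ i)
      · rw [if_pos h1, if_neg]
        exact fun h2 => hσ ⟨τ, h1, h2⟩
      · rw [if_neg h1]

theorem memLp_finset_prod_of_forall_memLp {Ω ι : Type*} [MeasurableSpace Ω] {P : Measure Ω}
    [IsProbabilityMeasure P] {X : ι → Ω → ℝ} (s : Finset ι)
    (hX : ∀ i, ∀ p : ENNReal, p ≠ ⊤ → MemLp (X i) p P) (p : ENNReal) (hp : p ≠ ⊤) :
    MemLp (fun ω => ∏ i ∈ s, X i ω) p P := by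
  rcases eq_or_ne p 0 with rfl | hp0
  · rw [memLp_zero_iff_aestronglyMeasurable]
    exact Finset.aestronglyMeasurable_fun_prod _ fun i _ => (hX i 1 (by simp)).1
  rcases s.eq_empty_or_nonempty with rfl | hs
  · simpa using memLp_const (1 : ℝ)
  have h := MemLp.prod' (s := s) (f := X) (p := fun _ => s.card * p) (μ := P) fun i _ =>
    hX i _ (ENNReal.mul_ne_top (by simp) hp)
  have hc : (s.card : ENNReal) ≠ 0 := by simpa using hs.ne_empty
  rw [Finset.sum_const, nsmul_eq_mul, ENNReal.mul_inv (Or.inl hc) (Or.inl (by simp)), inv_inv,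
    ← mul_assoc, ENNReal.inv_mul_cancel hc (by simp), one_mul] at h
  exact h

/-- The mean of a product of row sums and column sums of an independent centred array: only the
complete pairings of rows with columns survive. -/
theorem integral_prod_sum_mul_prod_sum {Ω ι : Type*} [MeasurableSpace Ω]
    {P : Measure Ω} [IsProbabilityMeasure P] [Fintype ι] [DecidableEq ι]
    {G : Option ι × Option ι → Ω → ℝ}
    (hG : iIndepFun G P) (mG : ∀ e, ∀ p : ENNReal, p ≠ ⊤ → MemLp (G e) p P)
    (cG : ∀ e, ∫ ω, G e ω ∂P = 0) :
    ∫ ω, (∏ i, ∑ b, G (some i, b) ω) * ∏ j, ∑ a, G (a, some j) ω ∂P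
      = ∑ σ : Equiv.Perm ι, ∏ i, ∫ ω, G (some i, some (σ i)) ω ^ 2 ∂P := by
  have h : ∀ ω, (∏ i, ∑ b, G (some i, b) ω) * ∏ j, ∑ a, G (a, some j) ω
      = ∑ a : ι → Option ι, ∑ b : ι → Option ι,
        (∏ i, G (some i, a i) ω) * ∏ j, G (b j, some j) ω := by
    intro ω
    rw [Finset.prod_univ_sum, Finset.prod_univ_sum, Fintype.piFinset_univ, Finset.sum_mul_sum]
  have hint : ∀ a b : ι → Option ι,
      Integrable (fun ω => (∏ i, G (some i, a i) ω) * ∏ j, G (b j, some j) ω) P := by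
    intro a b
    exact (memLp_finset_prod_of_forall_memLp _ (fun i => mG _) 2 (by simp)).integrable_mul
      (memLp_finset_prod_of_forall_memLp _ (fun i => mG _) 2 (by simp))
  simp_rw [h]
  rw [integral_finsetSum _ fun a _ => integrable_finsetSum _ fun b _ => hint a b]
  simp_rw [integral_finsetSum _ fun b _ => hint _ b]
  simp_rw [integral_prod_mul_prod_eq_sum_perm hG
    (fun e => (mG e 1 (by simp)).aestronglyMeasurable.aemeasurable) cG]
  rw [Finset.sum_congr rfl fun a _ => Finset.sum_comm, Finset.sum_comm]
  refine Finset.sum_congr rfl fun σ _ => ?_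
  rw [Finset.sum_eq_single fun i => some (σ i), Finset.sum_eq_single fun j => some (σ.symm j)]
  · simp
  · intro b _ hb
    simp [hb]
  · simp
  · intro a _ ha
    simp [ha]
  · simp

/-! ### White noise -/

section WhiteNoise

variable {d : ℕ} {Ω : Type*} [MeasurableSpace Ω] {P : Measure Ω}
  {ξ : Lp ℝ 2 (volume : Measure (SpaceTime d)) → Ω → ℝ}

theorem IsWhiteNoise.memLp (hξ : IsWhiteNoise P ξ) (h : Lp ℝ 2 (volume : Measure (SpaceTime d)))
    (p : ENNReal) (hp : p ≠ ⊤) : MemLp (ξ h) p P :=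
  (hξ.gaussian.hasGaussianLaw_eval h).memLp hp

theorem IsWhiteNoise.inner_toLp (hξ : IsWhiteNoise P ξ)
    (g h : Lp ℝ 2 (volume : Measure (SpaceTime d))) :
    inner ℝ ((hξ.memLp g 2 (by simp)).toLp (ξ g)) ((hξ.memLp h 2 (by simp)).toLp (ξ h))
      = inner ℝ g h := by
  rw [← hξ.covariance g h, L2.inner_def]
  refine integral_congr_ae ?_
  filter_upwards [(hξ.memLp g 2 (by simp)).coeFn_toLp, (hξ.memLp h 2 (by simp)).coeFn_toLp]
    with ω h1 h2
  rw [h1, h2]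
  simp [mul_comm]

/-- White noise as an additive map into `L²(P)`. Additivity is a consequence of the covariance. -/
def IsWhiteNoise.toLpHom (hξ : IsWhiteNoise P ξ) :
    Lp ℝ 2 (volume : Measure (SpaceTime d)) →+ Lp ℝ 2 P :=
  AddMonoidHom.mk' (fun h => (hξ.memLp h 2 (by simp)).toLp (ξ h)) fun g h => by
    rw [← sub_eq_zero, ← inner_self_eq_zero (𝕜 := ℝ)]
    simp only [inner_sub_left, inner_sub_right, inner_add_left, inner_add_right, hξ.inner_toLp]
    ring

theorem IsWhiteNoise.ae_sum (hξ : IsWhiteNoise P ξ) {ι : Type*} (s : Finset ι)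
    (h : ι → Lp ℝ 2 (volume : Measure (SpaceTime d))) :
    ξ (∑ i ∈ s, h i) =ᵐ[P] fun ω => ∑ i ∈ s, ξ (h i) ω := by
  have h1 := map_sum hξ.toLpHom h s
  have h2 : ∀ g, hξ.toLpHom g =ᵐ[P] ξ g := fun g => (hξ.memLp g 2 (by simp)).coeFn_toLp
  have h3 := Lp.coeFn_finsetSum s fun i => hξ.toLpHom (h i)
  rw [← h1] at h3
  have h4 : ∀ᵐ ω ∂P, ∀ i ∈ s, hξ.toLpHom (h i) ω = ξ (h i) ω :=
    (Filter.eventually_all_finset s).2 fun i _ => h2 (h i)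
  filter_upwards [h2 (∑ i ∈ s, h i), h3, h4] with ω e1 e2 e3
  rw [← e1, e2, Finset.sum_apply]
  exact Finset.sum_congr rfl e3

theorem IsWhiteNoise.iIndepFun (hξ : IsWhiteNoise P ξ) {E : Type*} [Fintype E]
    (h : E → Lp ℝ 2 (volume : Measure (SpaceTime d)))
    (horth : ∀ e e', e ≠ e' → inner ℝ (h e) (h e') = 0) :
    iIndepFun (fun e => ξ (h e)) P := by
  have := hξ.gaussian.isProbabilityMeasure
  refine HasGaussianLaw.iIndepFun_of_covariance_eq_zero ?_ fun e e' hee => ?_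
  · exact ((hξ.gaussian.comp_right h).hasGaussianLaw Finset.univ).map_fun
      (ContinuousLinearMap.pi fun e : E =>
        ContinuousLinearMap.proj (R := ℝ) (φ := fun _ : (Finset.univ : Finset E) => ℝ)
          ⟨e, Finset.mem_univ e⟩)
  · rw [covariance_eq_sub (hξ.memLp _ 2 (by simp)) (hξ.memLp _ 2 (by simp)), hξ.centred,
      hξ.centred]
    simpa [horth e e' hee] using hξ.covariance (h e) (h e')

theorem indicatorConstLp_eq_sum {X ι : Type*} [MeasurableSpace X] {μ : Measure X} [Fintype ι]
    {s : Set X} (hs : MeasurableSet s) (hμs : μ s ≠ ⊤) (T : ι → Set X)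
    (hT : ∀ i, MeasurableSet (T i)) (hμT : ∀ i, μ (T i) ≠ ⊤)
    (hdisj : ∀ i j, i ≠ j → Disjoint (T i) (T j)) (hU : s = ⋃ i, T i) :
    indicatorConstLp 2 hs hμs (1 : ℝ) = ∑ i, indicatorConstLp 2 (hT i) (hμT i) (1 : ℝ) := by
  refine Lp.ext ?_
  have h4 : ∀ᵐ x ∂μ, ∀ i, indicatorConstLp 2 (hT i) (hμT i) (1 : ℝ) x
      = (T i).indicator (fun _ => (1 : ℝ)) x := ae_all_iff.2 fun i => indicatorConstLp_coeFn
  filter_upwards [indicatorConstLp_coeFn (p := 2) (hs := hs) (hμs := hμs) (c := (1 : ℝ)),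
    Lp.coeFn_finsetSum Finset.univ fun i => indicatorConstLp 2 (hT i) (hμT i) (1 : ℝ), h4]
    with x e1 e2 e3
  rw [e1, e2, Finset.sum_apply]
  simp_rw [e3]
  subst hU
  by_cases hx : x ∈ ⋃ i, T i
  · obtain ⟨i, hi⟩ := Set.mem_iUnion.1 hx
    rw [Finset.sum_eq_single i]
    · simp [hx, hi]
    · intro j _ hj
      exact Set.indicator_of_notMem (fun h => (hdisj j i hj).le_bot ⟨h, hi⟩) _
    · simp
  · rw [Set.indicator_of_notMem hx, Finset.sum_eq_zero]
    intro i _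
    exact Set.indicator_of_notMem (fun h => hx (Set.mem_iUnion.2 ⟨i, h⟩)) _

/-- The covariance of two products of white noises, each over a family of disjoint sets. -/
theorem IsWhiteNoise.integral_prod_mul_prod (hξ : IsWhiteNoise P ξ) {ι : Type*} [Fintype ι]
    [DecidableEq ι] {A B : ι → Set (SpaceTime d)}
    (hA : ∀ i, MeasurableSet (A i)) (hB : ∀ i, MeasurableSet (B i))
    (hAf : ∀ i, volume (A i) ≠ ⊤) (hBf : ∀ i, volume (B i) ≠ ⊤)
    (hAd : ∀ i j, i ≠ j → Disjoint (A i) (A j)) (hBd : ∀ i j, i ≠ j → Disjoint (B i) (B j)) :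
    ∫ ω, (∏ i, ξ (indicatorConstLp 2 (hA i) (hAf i) (1 : ℝ)) ω)
        * ∏ j, ξ (indicatorConstLp 2 (hB j) (hBf j) (1 : ℝ)) ω ∂P
      = ∑ σ : Equiv.Perm ι, ∏ i, volume.real (A i ∩ B (σ i)) := by
  have := hξ.gaussian.isProbabilityMeasure
  -- Both families are completed to partitions of their common union `U`, and the noise is
  -- evaluated on the cells of the joint refinement.
  set U : Set (SpaceTime d) := (⋃ i, A i) ∪ ⋃ j, B j
  have hAU : ∀ i, A i ⊆ U := fun i => (Set.subset_iUnion A i).trans Set.subset_union_left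
  have hBU : ∀ i, B i ⊆ U := fun i => (Set.subset_iUnion B i).trans Set.subset_union_right
  have hUm : MeasurableSet U := (MeasurableSet.iUnion hA).union (MeasurableSet.iUnion hB)
  have hUf : volume U ≠ ⊤ := by
    refine (measure_union_lt_top ?_ ?_).ne
    · exact (measure_iUnion_le _).trans_lt (by
        rw [tsum_fintype]
        exact ENNReal.sum_lt_top.2 fun i _ => (hAf i).lt_top)
    · exact (measure_iUnion_le _).trans_lt (by
        rw [tsum_fintype]
        exact ENNReal.sum_lt_top.2 fun i _ => (hBf i).lt_top)
  let part : (ι → Set (SpaceTime d)) → Option ι → Set (SpaceTime d) :=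
    fun F o => o.elim (U \ ⋃ i, F i) F
  have hpm : ∀ F : ι → Set (SpaceTime d), (∀ i, MeasurableSet (F i)) →
      ∀ o, MeasurableSet (part F o) := by
    rintro F hF (_ | i)
    · exact hUm.diff (MeasurableSet.iUnion hF)
    · exact hF i
  have hpd : ∀ F : ι → Set (SpaceTime d), (∀ i j, i ≠ j → Disjoint (F i) (F j)) →
      ∀ o o', o ≠ o' → Disjoint (part F o) (part F o') := by
    have hnone : ∀ (F : ι → Set (SpaceTime d)) i, Disjoint (U \ ⋃ i, F i) (F i) := fun F i =>
      Set.disjoint_sdiff_left.mono_right (Set.subset_iUnion F i)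
    rintro F hF (_ | i) (_ | j) h
    · exact absurd rfl h
    · exact hnone F j
    · exact (hnone F i).symm
    · exact hF i j fun h' => h (by rw [h'])
  have hpU : ∀ F : ι → Set (SpaceTime d), U ⊆ ⋃ o, part F o := by
    intro F x hx
    by_cases h : x ∈ ⋃ i, F i
    · obtain ⟨i, hi⟩ := Set.mem_iUnion.1 h
      exact Set.mem_iUnion.2 ⟨some i, hi⟩
    · exact Set.mem_iUnion.2 ⟨none, hx, h⟩
  let S : Option ι × Option ι → Set (SpaceTime d) := fun e => U ∩ (part A e.1 ∩ part B e.2)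
  have hSm : ∀ e, MeasurableSet (S e) := fun e => hUm.inter ((hpm A hA _).inter (hpm B hB _))
  have hSf : ∀ e, volume (S e) ≠ ⊤ := fun e => measure_ne_top_of_subset Set.inter_subset_left hUf
  have hSd : ∀ e e', e ≠ e' → Disjoint (S e) (S e') := by
    rintro ⟨a, b⟩ ⟨a', b'⟩ h
    by_cases ha : a = a'
    · have hb : b ≠ b' := fun hb => h (by rw [ha, hb])
      exact (hpd B hBd b b' hb).mono (fun x hx => hx.2.2) fun x hx => hx.2.2
    · exact (hpd A hAd a a' ha).mono (fun x hx => hx.2.1) fun x hx => hx.2.1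
  let h : Option ι × Option ι → Lp ℝ 2 (volume : Measure (SpaceTime d)) := fun e =>
    indicatorConstLp 2 (hSm e) (hSf e) (1 : ℝ)
  have hin : ∀ e e', inner ℝ (h e) (h e') = volume.real (S e ∩ S e') := fun e e' =>
    L2.real_inner_indicatorConstLp_one_indicatorConstLp_one (hSm e) (hSm e') (hSf e) (hSf e')
  have horth : ∀ e e', e ≠ e' → inner ℝ (h e) (h e') = 0 := by
    intro e e' hee
    rw [hin, (hSd e e' hee).inter_eq, measureReal_empty]
  have hfA : ∀ i, indicatorConstLp 2 (hA i) (hAf i) (1 : ℝ) = ∑ b, h (some i, b) := by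
    intro i
    refine indicatorConstLp_eq_sum _ _ _ (fun b => hSm (some i, b)) (fun b => hSf (some i, b))
      (fun b b' hb => hSd _ _ fun e => hb (congrArg Prod.snd e)) ?_
    ext x
    simp only [Set.mem_iUnion]
    constructor
    · intro hx
      obtain ⟨b, hb⟩ := Set.mem_iUnion.1 (hpU B (hAU i hx))
      exact ⟨b, hAU i hx, hx, hb⟩
    · rintro ⟨b, -, hx, -⟩
      exact hx
  have hfB : ∀ j, indicatorConstLp 2 (hB j) (hBf j) (1 : ℝ) = ∑ a, h (a, some j) := by
    intro j
    refine indicatorConstLp_eq_sum _ _ _ (fun a => hSm (a, some j)) (fun a => hSf (a, some j))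
      (fun b b' hb => hSd _ _ fun e => hb (congrArg Prod.fst e)) ?_
    ext x
    simp only [Set.mem_iUnion]
    constructor
    · intro hx
      obtain ⟨a, ha⟩ := Set.mem_iUnion.1 (hpU A (hBU j hx))
      exact ⟨a, hBU j hx, ha, hx⟩
    · rintro ⟨a, -, -, hx⟩
      exact hx
  have hae1 : ∀ᵐ ω ∂P, ∀ i, ξ (indicatorConstLp 2 (hA i) (hAf i) (1 : ℝ)) ω
      = ∑ b, ξ (h (some i, b)) ω :=
    ae_all_iff.2 fun i => by rw [hfA i]; exact hξ.ae_sum _ _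
  have hae2 : ∀ᵐ ω ∂P, ∀ j, ξ (indicatorConstLp 2 (hB j) (hBf j) (1 : ℝ)) ω
      = ∑ a, ξ (h (a, some j)) ω :=
    ae_all_iff.2 fun i => by rw [hfB i]; exact hξ.ae_sum _ _
  rw [integral_congr_ae (g := fun ω => (∏ i, ∑ b, ξ (h (some i, b)) ω)
    * ∏ j, ∑ a, ξ (h (a, some j)) ω)]
  · rw [integral_prod_sum_mul_prod_sum (hξ.iIndepFun h horth) (fun e => hξ.memLp _)
      fun e => hξ.centred _]
    refine Finset.sum_congr rfl fun σ _ => Finset.prod_congr rfl fun i _ => ?_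
    simp_rw [sq]
    rw [hξ.covariance, hin, Set.inter_self]
    congr 1
    exact Set.inter_eq_right.2 fun x hx => hAU i hx.1
  · filter_upwards [hae1, hae2] with ω e1 e2
    simp_rw [e1, e2]

end WhiteNoise

/-! ### The bound on multiple Wiener integrals -/

section Wiener

variable {d : ℕ} {Ω : Type*} [MeasurableSpace Ω] {P : Measure Ω}
  {ξ : Lp ℝ 2 (volume : Measure (SpaceTime d)) → Ω → ℝ} {k : ℕ}

theorem measurePreserving_comp_perm (d : ℕ) {k : ℕ} (σ : Equiv.Perm (Fin k)) :
    MeasurePreserving (fun (z : Fin k → SpaceTime d) (i : Fin k) => z (σ.symm i))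
      volume volume := by
  convert volume_measurePreserving_piCongrLeft (fun _ : Fin k => SpaceTime d) σ using 1
  funext z i
  obtain ⟨j, rfl⟩ := σ.surjective i
  rw [MeasurableEquiv.coe_piCongrLeft, Equiv.piCongrLeft_apply_apply, σ.symm_apply_apply]

/-- The permutation of variables `f ↦ f(z_{σ⁻¹(1)}, …, z_{σ⁻¹(k)})` on `L²(ℝ^{1+d})^{⊗k}`. -/
def permKernel (σ : Equiv.Perm (Fin k)) : KernelSpace d k →ₗᵢ[ℝ] KernelSpace d k :=
  Lp.compMeasurePreservingₗᵢ ℝ (fun (z : Fin k → SpaceTime d) (i : Fin k) => z (σ.symm i))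
    (measurePreserving_comp_perm d σ)

theorem volume_real_univ_pi (A : Fin k → Set (SpaceTime d)) :
    (volume : Measure (Fin k → SpaceTime d)).real (Set.univ.pi A) = ∏ i, volume.real (A i) := by
  simp [measureReal_def, volume_pi_pi, ENNReal.toReal_prod]

theorem inner_permKernel_of_elementary {A B : Fin k → Set (SpaceTime d)}
    (hA : ∀ i, MeasurableSet (A i)) (hB : ∀ i, MeasurableSet (B i))
    {f g : KernelSpace d k}
    (hf : f =ᵐ[volume] (Set.univ.pi A).indicator (fun _ => (1 : ℝ)))
    (hg : g =ᵐ[volume] (Set.univ.pi B).indicator (fun _ => (1 : ℝ))) (σ : Equiv.Perm (Fin k)) :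
    inner ℝ f (permKernel σ g) = ∏ i, volume.real (A i ∩ B (σ i)) := by
  have hσ := measurePreserving_comp_perm d σ
  rw [L2.inner_def, ← volume_real_univ_pi,
    ← integral_indicator_one (MeasurableSet.univ_pi fun i => (hA i).inter (hB (σ i)))]
  refine integral_congr_ae ?_
  have h1 : permKernel σ g =ᵐ[volume] fun z => g fun i => z (σ.symm i) :=
    Lp.coeFn_compMeasurePreserving g hσ
  filter_upwards [hf, h1, hσ.quasiMeasurePreserving.ae hg] with z e1 e2 e3
  rw [e1, e2, e3]
  have hiff : ((fun i => z (σ.symm i)) ∈ Set.univ.pi B) ↔ ∀ i, z i ∈ B (σ i) := by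
    rw [Set.mem_univ_pi]
    exact ⟨fun h i => by simpa using h (σ i), fun h i => by simpa using h (σ.symm i)⟩
  by_cases h1 : z ∈ Set.univ.pi A <;> by_cases h2 : ∀ i, z i ∈ B (σ i)
  · have h3 : z ∈ Set.univ.pi fun i => A i ∩ B (σ i) := fun i hi => ⟨h1 i hi, h2 i⟩
    simp [Set.indicator_of_mem h1, Set.indicator_of_mem (hiff.2 h2), Set.indicator_of_mem h3]
  · have h3 : z ∉ Set.univ.pi fun i => A i ∩ B (σ i) := fun h => h2 fun i => (h i trivial).2
    simp [Set.indicator_of_notMem (fun h => h2 (hiff.1 h)), Set.indicator_of_notMem h3]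
  · have h3 : z ∉ Set.univ.pi fun i => A i ∩ B (σ i) := fun h => h1 fun i hi => (h i hi).1
    simp [Set.indicator_of_notMem h1, Set.indicator_of_notMem h3]
  · have h3 : z ∉ Set.univ.pi fun i => A i ∩ B (σ i) := fun h => h1 fun i hi => (h i hi).1
    simp [Set.indicator_of_notMem h1, Set.indicator_of_notMem h3]

theorem inner_snd_eq_of_elementary (hξ : IsWhiteNoise P ξ) {p q : KernelSpace d k × Lp ℝ 2 P}
    (hp : p ∈ elementaryPairs P ξ k) (hq : q ∈ elementaryPairs P ξ k) :
    inner ℝ p.2 q.2 = ∑ σ : Equiv.Perm (Fin k), inner ℝ p.1 (permKernel σ q.1) := by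
  obtain ⟨A, hA, hAf, hAd, hpA, hpY⟩ := hp
  obtain ⟨B, hB, hBf, hBd, hqB, hqY⟩ := hq
  simp_rw [inner_permKernel_of_elementary hA hB hpA hqB]
  rw [← hξ.integral_prod_mul_prod hA hB hAf hBf hAd hBd, L2.inner_def]
  refine integral_congr_ae ?_
  filter_upwards [hpY, hqY] with ω e1 e2
  rw [e1, e2]
  simp [mul_comm]

/-- The covariance of multiple Wiener integrals: `E[I_k(f) I_k(g)]` is the sum of the inner products
of `f` with all the permutations of `g`. -/
theorem inner_snd_eq_of_mem_span (hξ : IsWhiteNoise P ξ) {p q : KernelSpace d k × Lp ℝ 2 P}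
    (hp : p ∈ Submodule.span ℝ (elementaryPairs P ξ k))
    (hq : q ∈ Submodule.span ℝ (elementaryPairs P ξ k)) :
    inner ℝ p.2 q.2 = ∑ σ : Equiv.Perm (Fin k), inner ℝ p.1 (permKernel σ q.1) := by
  induction hp using Submodule.span_induction with
  | mem p hp =>
    induction hq using Submodule.span_induction with
    | mem q hq => exact inner_snd_eq_of_elementary hξ hp hq
    | zero => simp
    | add q q' _ _ h h' => simp [inner_add_right, Finset.sum_add_distrib, h, h']
    | smul c q _ h => simp [inner_smul_right, Finset.mul_sum, h]
  | zero => simp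
  | add p p' _ _ h h' => simp [inner_add_left, Finset.sum_add_distrib, h, h']
  | smul c p _ h => simp [inner_smul_left, Finset.mul_sum, h]

/-- The bound `‖I_k(f)‖² ≤ k! ‖f‖²`, which passes from the elementary functions to the closure. -/
theorem norm_snd_sq_le_of_mem_wienerGraph (hξ : IsWhiteNoise P ξ)
    {p : KernelSpace d k × Lp ℝ 2 P} (hp : p ∈ wienerGraph P ξ k) :
    ‖p.2‖ ^ 2 ≤ k.factorial * ‖p.1‖ ^ 2 := by
  have hcl : IsClosed {p : KernelSpace d k × Lp ℝ 2 P |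
      ‖p.2‖ ^ 2 ≤ k.factorial * ‖p.1‖ ^ 2} :=
    isClosed_le (by fun_prop) (by fun_prop)
  refine closure_minimal (fun q hq => ?_) hcl hp
  have h := inner_snd_eq_of_mem_span hξ hq hq
  rw [Set.mem_ofPred_eq, ← real_inner_self_eq_norm_sq, h]
  calc ∑ σ : Equiv.Perm (Fin k), inner ℝ q.1 (permKernel σ q.1)
      ≤ ∑ _σ : Equiv.Perm (Fin k), ‖q.1‖ ^ 2 := by
        refine Finset.sum_le_sum fun σ _ => (real_inner_le_norm _ _).trans ?_
        rw [LinearIsometry.norm_map, sq]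
    _ = k.factorial * ‖q.1‖ ^ 2 := by
        simp [Finset.card_univ, Fintype.card_perm]

/-! ### Density of off-diagonal elementary functions -/

instance isAddHaarMeasure_volume_spaceTime (d : ℕ) :
    (volume : Measure (SpaceTime d)).IsAddHaarMeasure := by
  rw [Measure.volume_eq_prod]; infer_instance

/-- Almost every point of `(ℝ^{1+d})^k` is off the diagonals. -/
theorem ae_injective_spaceTime (d k : ℕ) :
    ∀ᵐ z : Fin k → SpaceTime d, Function.Injective z := by
  have h : ∀ᵐ z : Fin k → SpaceTime d, ∀ i j : Fin k, i ≠ j → z i ≠ z j := by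
    rw [ae_all_iff]
    intro i
    rw [ae_all_iff]
    intro j
    by_cases hij : i = j
    · simp [hij]
    · -- The diagonal is a proper linear subspace.
      let L : (Fin k → SpaceTime d) →ₗ[ℝ] SpaceTime d :=
        LinearMap.proj (R := ℝ) (φ := fun _ : Fin k => SpaceTime d) i - LinearMap.proj j
      have hL : LinearMap.ker L ≠ ⊤ := by
        rw [Ne, LinearMap.ker_eq_top]
        intro h0
        have := LinearMap.congr_fun h0 (Pi.single i ((1 : ℝ), (0 : Fin d → ℝ)))
        simp [L, Pi.single_eq_of_ne (Ne.symm hij)] at this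
      have h0 := Measure.addHaar_submodule (volume : Measure (Fin k → SpaceTime d)) _ hL
      filter_upwards [measure_eq_zero_iff_ae_notMem.1 h0] with z hz _ hzz
      exact hz (by simp [L, hzz])
  filter_upwards [h] with z hz i j hij
  by_contra hne
  exact hz i j hne hij

/-- The set of points of `(ℝ^{1+d})^k` off the diagonals is covered by countably many products of
pairwise disjoint open sets of finite measure. -/
theorem exists_countable_cover_offDiag (d k : ℕ) :
    ∃ 𝒰 : Set (Fin k → Set (SpaceTime d)), 𝒰.Countable ∧
      (∀ U ∈ 𝒰, (∀ i, IsOpen (U i)) ∧ (∀ i, volume (U i) ≠ ⊤) ∧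
        ∀ i j, i ≠ j → Disjoint (U i) (U j)) ∧
      ∀ z : Fin k → SpaceTime d, Function.Injective z → ∃ U ∈ 𝒰, z ∈ Set.univ.pi U := by
  let b := TopologicalSpace.countableBasis (SpaceTime d)
  have hb : TopologicalSpace.IsTopologicalBasis b :=
    TopologicalSpace.isBasis_countableBasis (SpaceTime d)
  refine ⟨{U | (∀ i, U i ∈ b) ∧ (∀ i, volume (U i) ≠ ⊤) ∧ ∀ i j, i ≠ j → Disjoint (U i) (U j)},
    ?_, ?_, ?_⟩
  · exact (Set.countable_pi fun _ : Fin k =>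
      TopologicalSpace.countable_countableBasis (SpaceTime d)).mono fun U hU i => hU.1 i
  · rintro U ⟨h1, h2, h3⟩
    exact ⟨fun i => hb.isOpen (h1 i), h2, h3⟩
  · intro z hz
    obtain ⟨V, hV, hVd⟩ := (Set.finite_range z).t2_separation
    have h : ∀ i, ∃ u ∈ b, z i ∈ u ∧ u ⊆ V (z i) ∩ Metric.ball (z i) 1 := fun i =>
      hb.exists_subset_of_mem_open ⟨(hV (z i)).1, Metric.mem_ball_self one_pos⟩
        ((hV (z i)).2.inter Metric.isOpen_ball)
    choose U hU hzU hUV using h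
    refine ⟨U, ⟨hU, fun i => ?_, fun i j hij => ?_⟩, fun i _ => hzU i⟩
    · exact measure_ne_top_of_subset ((hUV i).trans Set.inter_subset_right)
        measure_ball_lt_top.ne
    · exact (hVd ⟨i, rfl⟩ ⟨j, rfl⟩ (hz.ne hij)).mono ((hUV i).trans Set.inter_subset_left)
        ((hUV j).trans Set.inter_subset_left)

/-- A kernel whose integrals over all products of pairwise disjoint sets of finite measure vanish
is zero: such products form a π-system that generates the Borel sets off the diagonals. -/
theorem eq_zero_of_forall_setIntegral_pi_eq_zero (f : KernelSpace d k)
    (hf : ∀ A : Fin k → Set (SpaceTime d), (∀ i, MeasurableSet (A i)) →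
      (∀ i, volume (A i) ≠ ⊤) → (∀ i j, i ≠ j → Disjoint (A i) (A j)) →
      ∫ z in Set.univ.pi A, f z = 0) : f = 0 := by
  obtain ⟨𝒰, h𝒰c, h𝒰, hcov⟩ := exists_countable_cover_offDiag d k
  have hloc : ∀ U ∈ 𝒰, ∀ᵐ z, z ∈ Set.univ.pi U → f z = 0 := by
    intro U hU
    obtain ⟨hUo, hUf, hUd⟩ := h𝒰 U hU
    have hUm : MeasurableSet (Set.univ.pi U) := MeasurableSet.univ_pi fun i => (hUo i).measurableSet
    have hUpf : volume (Set.univ.pi U) ≠ ⊤ := by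
      rw [volume_pi_pi]
      exact ENNReal.prod_ne_top fun i _ => hUf i
    have hint : IntegrableOn f (Set.univ.pi U) :=
      integrableOn_Lp_of_measure_ne_top f fact_one_le_two_ennreal.elim hUpf
    have hall : ∀ s : Set (Fin k → SpaceTime d), MeasurableSet s →
        ∫ z in s, f z ∂(volume.restrict (Set.univ.pi U)) = 0 := by
      intro s hs
      have hgen : (inferInstance : MeasurableSpace (Fin k → SpaceTime d))
          = MeasurableSpace.generateFrom
            (Set.univ.pi '' Set.univ.pi fun _ : Fin k => {s | MeasurableSet s}) :=
        generateFrom_pi.symm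
      have hrect : ∀ A : Fin k → Set (SpaceTime d), (∀ i, MeasurableSet (A i)) →
          ∫ z in Set.univ.pi A, f z ∂(volume.restrict (Set.univ.pi U)) = 0 := by
        intro A hA
        rw [Measure.restrict_restrict (MeasurableSet.univ_pi hA), ← Set.pi_inter_distrib]
        exact hf _ (fun i => (hA i).inter (hUo i).measurableSet)
          (fun i => measure_ne_top_of_subset Set.inter_subset_right (hUf i))
          fun i j hij => (hUd i j hij).mono Set.inter_subset_right Set.inter_subset_right
      induction s, hs using MeasurableSpace.induction_on_inter hgen isPiSystem_pi with
      | empty => simp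
      | basic t ht =>
        obtain ⟨A, hA, rfl⟩ := ht
        exact hrect A fun i => hA i trivial
      | compl t ht ih =>
        have h1 := integral_add_compl ht hint
        have h2 := hrect (fun _ => Set.univ) fun _ => MeasurableSet.univ
        rw [Set.pi_univ, setIntegral_univ] at h2
        rw [ih, h2, zero_add] at h1
        exact h1
      | iUnion t htd htm ih =>
        rw [integral_iUnion htm htd hint.integrableOn]
        simp [ih]
    have h0 := Integrable.ae_eq_zero_of_forall_setIntegral_eq_zero hint
      fun s hs _ => hall s hs
    exact (ae_restrict_iff' hUm).1 h0
  refine (Lp.eq_zero_iff_ae_eq_zero).2 ?_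
  have hall : ∀ᵐ z, ∀ U ∈ 𝒰, z ∈ Set.univ.pi U → f z = 0 := (ae_ball_iff h𝒰c).2 hloc
  filter_upwards [hall, ae_injective_spaceTime d k] with z h1 h2
  obtain ⟨U, hU, hz⟩ := hcov z h2
  exact h1 U hU hz

theorem exists_mem_elementaryPairs (hξ : IsWhiteNoise P ξ) {A : Fin k → Set (SpaceTime d)}
    (hA : ∀ i, MeasurableSet (A i)) (hAf : ∀ i, volume (A i) ≠ ⊤)
    (hAd : ∀ i j, i ≠ j → Disjoint (A i) (A j)) (hpf : volume (Set.univ.pi A) ≠ ⊤) :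
    ∃ Y, (indicatorConstLp 2 (MeasurableSet.univ_pi hA) hpf (1 : ℝ), Y)
      ∈ elementaryPairs P ξ k := by
  have := hξ.gaussian.isProbabilityMeasure
  have hm := memLp_finset_prod_of_forall_memLp Finset.univ
    (fun i => hξ.memLp (indicatorConstLp 2 (hA i) (hAf i) (1 : ℝ))) 2 (by simp)
  exact ⟨hm.toLp _, A, hA, hAf, hAd,
    indicatorConstLp_coeFn (hs := MeasurableSet.univ_pi hA) (hμs := hpf), hm.coeFn_toLp⟩

/-- Every kernel has a multiple Wiener integral. -/
theorem exists_mem_wienerGraph (hξ : IsWhiteNoise P ξ) (f : KernelSpace d k) :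
    ∃ Y, (f, Y) ∈ wienerGraph P ξ k := by
  let S := wienerGraph P ξ k
  let π : S →L[ℝ] KernelSpace d k :=
    (ContinuousLinearMap.fst ℝ (KernelSpace d k) (Lp ℝ 2 P)).comp S.subtypeL
  have hScl : IsClosed (S : Set (KernelSpace d k × Lp ℝ 2 P)) :=
    Submodule.isClosed_topologicalClosure _
  have : CompleteSpace S := hScl.completeSpace_coe
  -- The projection of the graph to the kernels is bounded below, so it has closed range.
  have hanti : AntilipschitzWith (1 + k.factorial) π := by
    refine ContinuousLinearMap.antilipschitz_of_bound π fun p => ?_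
    have h := norm_snd_sq_le_of_mem_wienerGraph hξ p.2
    have hk : (0 : ℝ) ≤ k.factorial := Nat.cast_nonneg _
    have h2 : ‖(p : KernelSpace d k × Lp ℝ 2 P).2‖
        ≤ (1 + k.factorial) * ‖(p : KernelSpace d k × Lp ℝ 2 P).1‖ := by
      refine abs_le_of_sq_le_sq' ?_ (by positivity) |>.2
      nlinarith [sq_nonneg ‖(p : KernelSpace d k × Lp ℝ 2 P).1‖,
        mul_nonneg hk (sq_nonneg ‖(p : KernelSpace d k × Lp ℝ 2 P).1‖),
        mul_nonneg (mul_nonneg hk hk) (sq_nonneg ‖(p : KernelSpace d k × Lp ℝ 2 P).1‖)]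
    have h1 : ‖(p : KernelSpace d k × Lp ℝ 2 P).1‖
        ≤ (1 + k.factorial) * ‖(p : KernelSpace d k × Lp ℝ 2 P).1‖ :=
      le_mul_of_one_le_left (norm_nonneg _) (by linarith)
    have h3 := max_le h1 h2
    simpa [π, Prod.norm_def] using h3
  have hclosed : IsClosed (Set.range π) := hanti.isClosed_range π.uniformContinuous
  have hrange : (LinearMap.range (π : S →ₗ[ℝ] KernelSpace d k)) = ⊤ := by
    have hcl : IsClosed ((LinearMap.range (π : S →ₗ[ℝ] KernelSpace d k) :
        Submodule ℝ (KernelSpace d k)) : Set (KernelSpace d k)) := by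
      rw [LinearMap.coe_range]
      exact hclosed
    rw [← hcl.submodule_topologicalClosure_eq, Submodule.topologicalClosure_eq_top_iff,
      Submodule.eq_bot_iff]
    intro g hg
    refine eq_zero_of_forall_setIntegral_pi_eq_zero g fun A hA hAf hAd => ?_
    have hpf : volume (Set.univ.pi A) ≠ ⊤ := by
      rw [volume_pi_pi]
      exact ENNReal.prod_ne_top fun i _ => hAf i
    obtain ⟨Y, hY⟩ := exists_mem_elementaryPairs hξ hA hAf hAd hpf
    rw [← L2.inner_indicatorConstLp_one (𝕜 := ℝ) (MeasurableSet.univ_pi hA) hpf g]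
    exact (Submodule.mem_orthogonal _ _).1 hg _
      ⟨⟨_, Submodule.le_topologicalClosure _ (Submodule.subset_span hY)⟩, rfl⟩
  obtain ⟨p, hp⟩ : f ∈ LinearMap.range (π : S →ₗ[ℝ] KernelSpace d k) := hrange ▸ trivial
  have hp1 : (p : KernelSpace d k × Lp ℝ 2 P).1 = f := hp
  exact ⟨(p : KernelSpace d k × Lp ℝ 2 P).2, by rw [← hp1]; exact p.2⟩

theorem wienerIntegral_mem_wienerGraph (hξ : IsWhiteNoise P ξ) (f : KernelSpace d k) :
    (f, wienerIntegral P ξ k f) ∈ wienerGraph P ξ k := by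
  have h := exists_mem_wienerGraph hξ f
  rw [wienerIntegral, dif_pos h]
  exact h.choose_spec

/-- The multiple Wiener integral `I_k` as a linear map. Linearity holds because the graph is a
subspace that contains a unique pair over every kernel. -/
def wienerLinearMap (hξ : IsWhiteNoise P ξ) (k : ℕ) : KernelSpace d k →ₗ[ℝ] Lp ℝ 2 P :=
  have huniq : ∀ f Y Y', (f, Y) ∈ wienerGraph P ξ k → (f, Y') ∈ wienerGraph P ξ k → Y = Y' := by
    intro f Y Y' h h'
    have h1 := norm_snd_sq_le_of_mem_wienerGraph hξ (Submodule.sub_mem _ h h')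
    simpa [sub_eq_zero] using h1
  { toFun := wienerIntegral P ξ k
    map_add' := fun f g => huniq _ _ _ (wienerIntegral_mem_wienerGraph hξ _)
      (Submodule.add_mem _ (wienerIntegral_mem_wienerGraph hξ f)
        (wienerIntegral_mem_wienerGraph hξ g))
    map_smul' := fun c f => huniq _ _ _ (wienerIntegral_mem_wienerGraph hξ _)
      (Submodule.smul_mem _ c (wienerIntegral_mem_wienerGraph hξ f)) }

theorem norm_wienerLinearMap_le (hξ : IsWhiteNoise P ξ) (f : KernelSpace d k) :
    ‖wienerLinearMap hξ k f‖ ≤ √k.factorial * ‖f‖ := by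
  have h := norm_snd_sq_le_of_mem_wienerGraph hξ (wienerIntegral_mem_wienerGraph hξ f)
  refine (abs_le_of_sq_le_sq' ?_ (by positivity)).2
  rw [mul_pow, Real.sq_sqrt (Nat.cast_nonneg _)]
  exact h

end Wiener

/-! ### Weak integrals -/

section WeakIntegral

variable {X H : Type*} [MeasurableSpace X] {μ : Measure X}
  [NormedAddCommGroup H] [InnerProductSpace ℝ H]

theorem IsWeakIntegral.unique {f : X → H} {F F' : H} (h : IsWeakIntegral μ f F)
    (h' : IsWeakIntegral μ f F') : F = F' :=
  ext_inner_right ℝ fun g => (h g).2.trans (h' g).2.symm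

theorem IsWeakIntegral.weakIntegral_eq {f : X → H} {F : H} (h : IsWeakIntegral μ f F) :
    weakIntegral μ f = F := by
  have hex : ∃ F, IsWeakIntegral μ f F := ⟨F, h⟩
  rw [weakIntegral, dif_pos hex]
  exact hex.choose_spec.unique h

theorem IsWeakIntegral.sub {f f' : X → H} {F F' : H} (h : IsWeakIntegral μ f F)
    (h' : IsWeakIntegral μ f' F') : IsWeakIntegral μ (fun y => f y - f' y) (F - F') := by
  intro g
  simp only [inner_sub_left]
  exact ⟨(h g).1.sub (h' g).1, by rw [integral_sub (h g).1 (h' g).1, (h g).2, (h' g).2]⟩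

theorem IsWeakIntegral.add {f f' : X → H} {F F' : H} (h : IsWeakIntegral μ f F)
    (h' : IsWeakIntegral μ f' F') : IsWeakIntegral μ (fun y => f y + f' y) (F + F') := by
  intro g
  simp only [inner_add_left]
  exact ⟨(h g).1.add (h' g).1, by rw [integral_add (h g).1 (h' g).1, (h g).2, (h' g).2]⟩

theorem IsWeakIntegral.congr {f f' : X → H} {F : H} (h : IsWeakIntegral μ f F)
    (hff : f =ᵐ[μ] f') : IsWeakIntegral μ f' F := by
  intro g
  have hg : (fun y => inner ℝ (f y) g) =ᵐ[μ] fun y => inner ℝ (f' y) g := by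
    filter_upwards [hff] with y hy
    rw [hy]
  exact ⟨(h g).1.congr hg, (h g).2.trans (integral_congr_ae hg)⟩

variable [CompleteSpace H] [SigmaFinite μ]

/-- The squared norm of a Bochner integral is the double integral of the inner products, so it is
controlled by the integral of their absolute values, whatever bounded weight is inserted. -/
theorem norm_integral_smul_sq_le {f : X → H}
    (hB : Integrable (fun p : X × X => inner ℝ (f p.1) (f p.2)) (μ.prod μ))
    {θ : X → ℝ} (hθm : Measurable θ) (hθ : ∀ y, |θ y| ≤ 1)
    (hint : Integrable (fun y => θ y • f y) μ) :
    ‖∫ y, θ y • f y ∂μ‖ ^ 2 ≤ ∫ p, |inner ℝ (f p.1) (f p.2)| ∂(μ.prod μ) := by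
  have hθ2 : ∀ p : X × X, |θ p.1 * θ p.2| ≤ 1 := fun p => by
    rw [abs_mul]
    exact mul_le_one₀ (hθ _) (abs_nonneg _) (hθ _)
  have hB' : Integrable (fun p : X × X => (θ p.1 * θ p.2) * inner ℝ (f p.1) (f p.2))
      (μ.prod μ) := by
    refine hB.bdd_mul (c := 1) ?_ (Filter.Eventually.of_forall hθ2)
    exact ((hθm.comp measurable_fst).mul (hθm.comp measurable_snd)).aestronglyMeasurable
  have h : ‖∫ y, θ y • f y ∂μ‖ ^ 2
      = ∫ p, (θ p.1 * θ p.2) * inner ℝ (f p.1) (f p.2) ∂(μ.prod μ) := by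
    rw [integral_prod _ hB', ← real_inner_self_eq_norm_sq, ← integral_inner hint]
    refine integral_congr_ae (Filter.Eventually.of_forall fun y => ?_)
    simp only
    rw [real_inner_comm, ← integral_inner hint]
    refine integral_congr_ae (Filter.Eventually.of_forall fun y' => ?_)
    simp only [inner_smul_left, inner_smul_right]
    simp
    ring
  rw [h]
  refine integral_mono hB' hB.abs fun p => ?_
  refine (le_abs_self _).trans ?_
  rw [abs_mul]
  exact mul_le_of_le_one_left (abs_nonneg _) (hθ2 p)

/-- Truncation makes `f` Bochner integrable; the bounds on the truncated integrals are uniform, which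
gives integrability of `⟪f y, g⟫` and a bounded linear functional of `g`, hence `F` by Riesz. -/
theorem exists_isWeakIntegral_of_stronglyMeasurable {f : X → H} (hf : StronglyMeasurable f)
    (hB : Integrable (fun p : X × X => inner ℝ (f p.1) (f p.2)) (μ.prod μ)) :
    ∃ F, IsWeakIntegral μ f F ∧
      ‖F‖ ^ 2 ≤ ∫ p, |inner ℝ (f p.1) (f p.2)| ∂(μ.prod μ) := by
  set M := ∫ p, |inner ℝ (f p.1) (f p.2)| ∂(μ.prod μ)
  have hM0 : 0 ≤ M := integral_nonneg fun p => abs_nonneg _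
  -- The sets `S n` exhaust the space, and `f` is Bochner integrable on each of them.
  let S : ℕ → Set X := fun n => {y | ‖f y‖ ≤ n} ∩ spanningSets μ n
  have hSm : ∀ n, MeasurableSet (S n) := fun n =>
    (measurableSet_le hf.norm.measurable measurable_const).inter (measurableSet_spanningSets μ n)
  have hSf : ∀ n, IntegrableOn f (S n) μ := fun n => by
    refine Measure.integrableOn_of_bounded (M := n)
      (measure_ne_top_of_subset Set.inter_subset_right (measure_spanningSets_lt_top μ n).ne)
      hf.aestronglyMeasurable ?_
    exact (ae_restrict_iff' (hSm n)).2 (Filter.Eventually.of_forall fun y hy => hy.1)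
  have hcover : AECover μ Filter.atTop S := by
    refine ⟨Filter.Eventually.of_forall fun y => ?_, hSm⟩
    obtain ⟨n, hn⟩ := exists_nat_ge ‖f y‖
    obtain ⟨n', hn'⟩ := Set.mem_iUnion.1
      ((iUnion_spanningSets μ).symm ▸ Set.mem_univ y : y ∈ ⋃ i, spanningSets μ i)
    filter_upwards [Filter.eventually_ge_atTop n, Filter.eventually_ge_atTop n'] with i hi hi'
    exact ⟨hn.trans (by exact_mod_cast hi), monotone_spanningSets μ hi' hn'⟩
  have hbound : ∀ g n, ∫ y in S n, ‖inner ℝ (f y) g‖ ∂μ ≤ √M * ‖g‖ := by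
    intro g n
    -- With the sign of `⟪f y, g⟫` as weight, `|⟪f y, g⟫|` integrates to a pairing with `g`.
    let θ : X → ℝ := (S n).indicator fun y => if 0 ≤ inner ℝ (f y) g then 1 else -1
    have hθm : Measurable θ := by
      refine Measurable.indicator (Measurable.ite ?_ measurable_const measurable_const) (hSm n)
      exact measurableSet_le measurable_const (hf.inner stronglyMeasurable_const).measurable
    have hθ : ∀ y, |θ y| ≤ 1 := fun y => by
      by_cases hy : y ∈ S n
      · simp only [θ, Set.indicator_of_mem hy]
        split_ifs <;> simp
      · simp [θ, Set.indicator_of_notMem hy]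
    have hint : Integrable (fun y => θ y • f y) μ := by
      refine ((hSf n).integrable_indicator (hSm n)).mono
        (hθm.stronglyMeasurable.smul hf).aestronglyMeasurable
        (Filter.Eventually.of_forall fun y => ?_)
      by_cases hy : y ∈ S n
      · rw [norm_smul, Set.indicator_of_mem hy]
        exact mul_le_of_le_one_left (norm_nonneg _) (hθ y)
      · simp [θ, Set.indicator_of_notMem hy]
    have h1 := norm_integral_smul_sq_le hB hθm hθ hint
    have h2 : ∫ y in S n, ‖inner ℝ (f y) g‖ ∂μ = inner ℝ g (∫ y, θ y • f y ∂μ) := by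
      rw [← integral_inner hint, ← integral_indicator (hSm n)]
      refine integral_congr_ae (Filter.Eventually.of_forall fun y => ?_)
      by_cases hy : y ∈ S n
      · simp only [θ, Set.indicator_of_mem hy, inner_smul_right, real_inner_comm (f y) g,
          Real.norm_eq_abs]
        split_ifs with h0
        · rw [abs_of_nonneg h0, one_mul]
        · rw [abs_of_neg (not_le.1 h0), neg_one_mul]
      · simp [θ, Set.indicator_of_notMem hy]
    rw [h2, mul_comm]
    exact (real_inner_le_norm _ _).trans
      (mul_le_mul_of_nonneg_left (Real.le_sqrt_of_sq_le h1) (norm_nonneg _))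
  have hint : ∀ g, Integrable (fun y => inner ℝ (f y) g) μ := fun g =>
    hcover.integrable_of_integral_norm_bounded (√M * ‖g‖) (fun n => (hSf n).inner_const g)
      (Filter.Eventually.of_forall (hbound g))
  have hle : ∀ g, ‖∫ y, inner ℝ (f y) g ∂μ‖ ≤ √M * ‖g‖ := fun g =>
    (norm_integral_le_integral_norm _).trans
      (le_of_tendsto (hcover.integral_tendsto_of_countably_generated (hint g).norm)
        (Filter.Eventually.of_forall (hbound g)))
  let ℓ : H →ₗ[ℝ] ℝ :=
    { toFun := fun g => ∫ y, inner ℝ (f y) g ∂μ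
      map_add' := fun g g' => by
        simp only [inner_add_right]
        exact integral_add (hint g) (hint g')
      map_smul' := fun c g => by
        simp only [inner_smul_right, RingHom.id_apply, smul_eq_mul]
        exact integral_const_mul _ _ }
  let L : H →L[ℝ] ℝ := ℓ.mkContinuous (√M) hle
  refine ⟨(InnerProductSpace.toDual ℝ H).symm L, fun g => ⟨hint g, ?_⟩, ?_⟩
  · rw [InnerProductSpace.toDual_symm_apply]
    rfl
  · rw [LinearIsometryEquiv.norm_map]
    calc ‖L‖ ^ 2 ≤ √M ^ 2 :=
          pow_le_pow_left₀ (norm_nonneg _) (ℓ.mkContinuous_norm_le (Real.sqrt_nonneg _) hle) 2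
      _ = M := Real.sq_sqrt hM0

/-- A Hilbert space valued function `f` has a weak integral as soon as its covariance function
`⟪f y, f y'⟫` is integrable, even if `‖f‖` is not integrable; the squared norm of the weak integral
is bounded by the double integral of the absolute covariance. -/
theorem exists_isWeakIntegral {f : X → H} (hf : AEStronglyMeasurable f μ)
    (hB : Integrable (fun p : X × X => inner ℝ (f p.1) (f p.2)) (μ.prod μ)) :
    ∃ F, IsWeakIntegral μ f F ∧
      ‖F‖ ^ 2 ≤ ∫ p, |inner ℝ (f p.1) (f p.2)| ∂(μ.prod μ) := by
  have hpair : ∀ᵐ p ∂(μ.prod μ), inner ℝ (f p.1) (f p.2) = inner ℝ (hf.mk f p.1) (hf.mk f p.2) := by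
    filter_upwards [Measure.quasiMeasurePreserving_fst.ae hf.ae_eq_mk,
      Measure.quasiMeasurePreserving_snd.ae hf.ae_eq_mk] with p h1 h2
    rw [h1, h2]
  obtain ⟨F, hF, hFM⟩ := exists_isWeakIntegral_of_stronglyMeasurable hf.stronglyMeasurable_mk
    (hB.congr hpair)
  refine ⟨F, hF.congr hf.ae_eq_mk.symm, hFM.trans_eq ?_⟩
  refine integral_congr_ae ?_
  filter_upwards [hpair] with p hp
  rw [hp]

end WeakIntegral

/-! ### Power singularities on balls -/

section Singularity

variable {d : ℕ}

theorem integrableOn_norm_rpow_closedBall (hd : 0 < d) {p : ℝ} (hp : -(d : ℝ) < p) (R : ℝ) :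
    IntegrableOn (fun w : Fin d → ℝ => ‖w‖ ^ p) (Metric.closedBall 0 R) := by
  have : Nonempty (Fin d) := ⟨⟨0, hd⟩⟩
  have hR : (0 : ℝ) < |R| + 1 := by positivity
  have h : IntegrableOn (fun w : Fin d → ℝ => ‖w‖ ^ p) (Metric.ball 0 (|R| + 1)) := by
    rw [integrableOn_fun_norm_addHaar volume (f := fun y => y ^ p)]
    have h1 := (intervalIntegral.integrableOn_Ioo_rpow_iff (s := p + d - 1) hR).2 (by linarith)
    refine h1.congr_fun (fun y hy => ?_) measurableSet_Ioo
    have hd1 : ((d - 1 : ℕ) : ℝ) = d - 1 := by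
      rw [Nat.cast_sub hd, Nat.cast_one]
    simp only [Module.finrank_fin_fun, smul_eq_mul]
    rw [← Real.rpow_natCast, ← Real.rpow_add hy.1, hd1]
    congr 1
    ring
  exact h.mono_set (Metric.closedBall_subset_ball (by linarith [le_abs_self R]))

/-- The integral of `‖w‖ ^ p` over the unit ball of `ℝ^d`. -/
def ballMoment (d : ℕ) (p : ℝ) : ℝ :=
  ∫ w in Metric.closedBall (0 : Fin d → ℝ) 1, ‖w‖ ^ p

theorem ballMoment_nonneg (d : ℕ) (p : ℝ) : 0 ≤ ballMoment d p :=
  integral_nonneg fun _ => Real.rpow_nonneg (norm_nonneg _) _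

theorem setIntegral_norm_rpow_closedBall {R : ℝ} (hR : 0 < R) (p : ℝ) :
    ∫ w in Metric.closedBall (0 : Fin d → ℝ) R, ‖w‖ ^ p = R ^ (d + p) * ballMoment d p := by
  have h := Measure.setIntegral_comp_smul_of_pos (volume : Measure (Fin d → ℝ))
    (fun w => ‖w‖ ^ p) (Metric.closedBall (0 : Fin d → ℝ) 1) hR
  rw [smul_closedBall _ _ zero_le_one, smul_zero, mul_one, Real.norm_of_nonneg hR.le,
    Module.finrank_fin_fun, smul_eq_mul] at h
  simp_rw [norm_smul, Real.norm_of_nonneg hR.le,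
    Real.mul_rpow hR.le (norm_nonneg _)] at h
  rw [integral_const_mul, eq_inv_mul_iff_mul_eq₀ (by positivity)] at h
  rw [← h, Real.rpow_add hR, Real.rpow_natCast, ballMoment, mul_assoc]

/-- A majorant of `1_{B(x,R)}(y) 1_{B(x,R)}(y') ‖y - y'‖ ^ p` of convolution type. -/
def ballKernel (p R : ℝ) (x : Fin d → ℝ) (q : (Fin d → ℝ) × (Fin d → ℝ)) : ℝ :=
  (Metric.closedBall x R).indicator (fun _ => (1 : ℝ)) q.2 *
    (Metric.closedBall (0 : Fin d → ℝ) (2 * R)).indicator (fun w => ‖w‖ ^ p) (q.1 - q.2)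

theorem ballKernel_nonneg (p R : ℝ) (x : Fin d → ℝ) (q : (Fin d → ℝ) × (Fin d → ℝ)) :
    0 ≤ ballKernel p R x q :=
  mul_nonneg (Set.indicator_nonneg (fun _ _ => zero_le_one) _)
    (Set.indicator_nonneg (fun _ _ => Real.rpow_nonneg (norm_nonneg _) _) _)

theorem ballKernel_eq (p R : ℝ) (x : Fin d → ℝ) {q : (Fin d → ℝ) × (Fin d → ℝ)}
    (h1 : q.1 ∈ Metric.closedBall x R) (h2 : q.2 ∈ Metric.closedBall x R) :
    ballKernel p R x q = ‖q.1 - q.2‖ ^ p := by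
  have h3 : q.1 - q.2 ∈ Metric.closedBall (0 : Fin d → ℝ) (2 * R) := by
    rw [mem_closedBall_zero_iff, ← dist_eq_norm]
    rw [Metric.mem_closedBall] at h1 h2
    linarith [dist_triangle_right q.1 q.2 x]
  simp [ballKernel, Set.indicator_of_mem h2, Set.indicator_of_mem h3]

theorem integrable_ballKernel (hd : 0 < d) {p : ℝ} (hp : -(d : ℝ) < p) (R : ℝ)
    (x : Fin d → ℝ) : Integrable (ballKernel p R x) (volume.prod volume) := by
  have h1 : Integrable ((Metric.closedBall x R).indicator fun _ => (1 : ℝ)) :=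
    (integrable_indicator_iff measurableSet_closedBall).2
      (integrableOn_const measure_closedBall_lt_top.ne)
  have h2 := (integrableOn_norm_rpow_closedBall hd hp (2 * R)).integrable_indicator
    measurableSet_closedBall
  exact h1.convolution_integrand (ContinuousLinearMap.mul ℝ ℝ) h2

theorem integral_ballKernel (hd : 0 < d) {p : ℝ} (hp : -(d : ℝ) < p) {R : ℝ} (hR : 0 < R)
    (x : Fin d → ℝ) :
    ∫ q, ballKernel p R x q ∂(volume.prod volume)
      = (2 * R) ^ (2 * d + p) * ballMoment d p := by
  have h1 : Integrable ((Metric.closedBall x R).indicator fun _ => (1 : ℝ)) :=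
    (integrable_indicator_iff measurableSet_closedBall).2
      (integrableOn_const measure_closedBall_lt_top.ne)
  have h2 := (integrableOn_norm_rpow_closedBall hd hp (2 * R)).integrable_indicator
    measurableSet_closedBall
  have h3 := integral_convolution (ContinuousLinearMap.mul ℝ ℝ) h1 h2
  have h4 : (∫ y, (Metric.closedBall x R).indicator (fun _ => (1 : ℝ)) y) = (2 * R) ^ (d : ℝ) := by
    rw [integral_indicator measurableSet_closedBall, setIntegral_const, measureReal_def,
      Real.volume_pi_closedBall _ hR.le, ENNReal.toReal_ofReal (by positivity)]
    simp
  rw [integral_prod _ (integrable_ballKernel hd hp R x)]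
  refine h3.trans ?_
  have h2R : 0 < 2 * R := by linarith
  rw [integral_indicator measurableSet_closedBall (f := fun w : Fin d → ℝ => ‖w‖ ^ p),
    setIntegral_norm_rpow_closedBall h2R, h4, ContinuousLinearMap.mul_apply', ← mul_assoc,
    ← Real.rpow_add h2R]
  congr 2
  ring

theorem ae_fst_ne_snd (hd : 0 < d) :
    ∀ᵐ q : (Fin d → ℝ) × (Fin d → ℝ) ∂(volume.prod volume), q.1 ≠ q.2 := by
  have : Nonempty (Fin d) := ⟨⟨0, hd⟩⟩
  refine (Measure.ae_prod_iff_ae_ae (p := fun q : (Fin d → ℝ) × (Fin d → ℝ) => q.1 ≠ q.2)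
    (measurableSet_eq_fun measurable_fst measurable_snd).compl).2
    (Filter.Eventually.of_forall fun y => ?_)
  filter_upwards [measure_eq_zero_iff_ae_notMem.1 (measure_singleton (μ := volume) y)] with y' hy' h
  exact hy' h.symm

end Singularity

/-! ### Smeared kernels -/

section Smeared

variable {d k : ℕ}

/-- The spatial translation as a linear isometry. -/
def translateIsometry (x : Fin d → ℝ) : KernelSpace d k →ₗᵢ[ℝ] KernelSpace d k :=
  Lp.compMeasurePreservingₗᵢ ℝ (fun (z : Fin k → SpaceTime d) (i : Fin k) => z i - ((0 : ℝ), x))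
    (measurePreserving_translate d k x)

theorem translateKernel_eq (x : Fin d → ℝ) (f : KernelSpace d k) :
    translateKernel x f = translateIsometry x f := rfl

/-- The constant in the double integral bound for covariances that are sums of the singularities
`‖y - y'‖ ^ (q - ζ)`, `ζ ∈ Z`. -/
def singularConst (d : ℕ) (q : ℝ) (Z : Finset ℝ) : ℝ :=
  2 ^ (2 * d + q) * ∑ ζ ∈ Z, ballMoment d (q - ζ)

theorem singularConst_nonneg (d : ℕ) (q : ℝ) (Z : Finset ℝ) : 0 ≤ singularConst d q Z :=
  mul_nonneg (by positivity) (Finset.sum_nonneg fun _ _ => ballMoment_nonneg _ _)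

/-- The weak integral of a smeared kernel exists, with a bound on its norm, if the covariance of the
kernel has integrable singularities on the diagonal. The weight `w` is the spatial norm for the
kernels themselves and the scaled space-time norm for their time increments. -/
theorem exists_isWeakIntegral_smeared (hd : 0 < d) {q : ℝ} {Z : Finset ℝ}
    (hZ : ∀ ζ ∈ Z, 0 ≤ ζ ∧ ζ < q + d) {V : (Fin d → ℝ) → KernelSpace d k}
    (hV : AEStronglyMeasurable V volume) {w : (Fin d → ℝ) → ℝ} {D R A : ℝ} (hD : 0 ≤ D)
    (hR : 0 < R) (hw0 : ∀ u, 0 ≤ w u) (hw : ∀ u, ‖u‖ ≤ R → w u ≤ R)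
    (hVV : ∀ u u', u ≠ u' → |inner ℝ (V u) (V u')|
      ≤ D * ∑ ζ ∈ Z, (w u + w u') ^ ζ * ‖u - u'‖ ^ (q - ζ))
    {φ : (Fin d → ℝ) → ℝ} (hφ : Continuous φ) (x : Fin d → ℝ) (hA : 0 ≤ A)
    (hφA : ∀ y, |φ y| ≤ A) (hφR : ∀ y, y ∉ Metric.closedBall x R → φ y = 0) :
    ∃ F, IsWeakIntegral volume (fun y => φ y • translateKernel x (V (y - x))) F ∧
      ‖F‖ ^ 2 ≤ A ^ 2 * D * R ^ (2 * d + q) * singularConst d q Z := by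
  have h2R : 0 < 2 * R := by linarith
  set f : (Fin d → ℝ) → KernelSpace d k := fun y => φ y • translateKernel x (V (y - x)) with hf
  have hfm : AEStronglyMeasurable f volume := by
    have h1 : AEStronglyMeasurable (fun y => V (y - x)) volume :=
      hV.comp_measurePreserving (measurePreserving_sub_right volume x)
    exact hφ.aestronglyMeasurable.smul
      ((translateIsometry (k := k) x).continuous.comp_aestronglyMeasurable h1)
  have hinner : ∀ p : (Fin d → ℝ) × (Fin d → ℝ), inner ℝ (f p.1) (f p.2)
      = φ p.1 * φ p.2 * inner ℝ (V (p.1 - x)) (V (p.2 - x)) := by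
    intro p
    simp only [hf, translateKernel_eq, inner_smul_left, inner_smul_right,
      LinearIsometry.inner_map_map]
    simp
    ring
  let B : (Fin d → ℝ) × (Fin d → ℝ) → ℝ := fun p =>
    A ^ 2 * D * ∑ ζ ∈ Z, (2 * R) ^ ζ * ballKernel (q - ζ) R x p
  have hdom : ∀ᵐ p ∂((volume : Measure (Fin d → ℝ)).prod volume),
      |inner ℝ (f p.1) (f p.2)| ≤ B p := by
    filter_upwards [ae_fst_ne_snd hd] with p hp
    have hB0 : 0 ≤ B p := mul_nonneg (by positivity)
      (Finset.sum_nonneg fun ζ _ => mul_nonneg (by positivity) (ballKernel_nonneg _ _ _ _))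
    rw [hinner]
    by_cases h1 : p.1 ∈ Metric.closedBall x R
    swap
    · rw [hφR _ h1]
      simpa using hB0
    by_cases h2 : p.2 ∈ Metric.closedBall x R
    swap
    · rw [hφR _ h2]
      simpa using hB0
    have hne : p.1 - x ≠ p.2 - x := fun h => hp (sub_left_injective h)
    have hsum : ∑ ζ ∈ Z, (w (p.1 - x) + w (p.2 - x)) ^ ζ
        * ‖(p.1 - x) - (p.2 - x)‖ ^ (q - ζ)
        ≤ ∑ ζ ∈ Z, (2 * R) ^ ζ * ballKernel (q - ζ) R x p := by
      refine Finset.sum_le_sum fun ζ hζ => ?_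
      rw [ballKernel_eq _ _ _ h1 h2, sub_sub_sub_cancel_right]
      refine mul_le_mul_of_nonneg_right ?_ (Real.rpow_nonneg (norm_nonneg _) _)
      refine Real.rpow_le_rpow (add_nonneg (hw0 _) (hw0 _)) ?_ (hZ ζ hζ).1
      have e1 := hw (p.1 - x) (by rwa [← dist_eq_norm])
      have e2 := hw (p.2 - x) (by rwa [← dist_eq_norm])
      linarith
    calc |φ p.1 * φ p.2 * inner ℝ (V (p.1 - x)) (V (p.2 - x))|
        = |φ p.1| * |φ p.2| * |inner ℝ (V (p.1 - x)) (V (p.2 - x))| := by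
          rw [abs_mul, abs_mul]
      _ ≤ A * A * (D * ∑ ζ ∈ Z, (2 * R) ^ ζ * ballKernel (q - ζ) R x p) := by
          refine mul_le_mul (mul_le_mul (hφA _) (hφA _) (abs_nonneg _) hA)
            ((hVV _ _ hne).trans (mul_le_mul_of_nonneg_left hsum hD)) (abs_nonneg _)
            (mul_nonneg hA hA)
      _ = B p := by
          simp only [B]
          ring
  have hterm : ∀ ζ ∈ Z, Integrable (fun p => (2 * R) ^ ζ * ballKernel (q - ζ) R x p)
      ((volume : Measure (Fin d → ℝ)).prod volume) := fun ζ hζ =>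
    (integrable_ballKernel hd (by linarith [(hZ ζ hζ).2]) R x).const_mul _
  have hBint : Integrable B ((volume : Measure (Fin d → ℝ)).prod volume) :=
    (integrable_finsetSum Z hterm).const_mul _
  have hBval : ∫ p, B p ∂((volume : Measure (Fin d → ℝ)).prod volume)
      = A ^ 2 * D * R ^ (2 * d + q) * singularConst d q Z := by
    simp only [B]
    rw [integral_const_mul, integral_finsetSum Z hterm, singularConst, mul_assoc _ (R ^ _),
      ← mul_assoc (R ^ _), ← Real.mul_rpow hR.le zero_le_two, mul_comm R 2]
    refine congrArg (A ^ 2 * D * ·) ?_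
    rw [Finset.mul_sum]
    refine Finset.sum_congr rfl fun ζ hζ => ?_
    rw [integral_const_mul, integral_ballKernel hd (by linarith [(hZ ζ hζ).2]) hR, ← mul_assoc,
      ← Real.rpow_add h2R]
    congr 2
    ring
  have hint : Integrable (fun p : (Fin d → ℝ) × (Fin d → ℝ) => inner ℝ (f p.1) (f p.2))
      ((volume : Measure (Fin d → ℝ)).prod volume) := by
    refine hBint.mono' ?_ hdom
    exact (hfm.comp_quasiMeasurePreserving Measure.quasiMeasurePreserving_fst).inner
      (hfm.comp_quasiMeasurePreserving Measure.quasiMeasurePreserving_snd)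
  obtain ⟨F, hF, hFle⟩ := exists_isWeakIntegral hfm hint
  exact ⟨F, hF, hFle.trans ((integral_mono_ae hint.abs hBint hdom).trans_eq hBval)⟩

theorem scaledTest_continuous {r : ℕ} {φ : (Fin d → ℝ) → ℝ} (hφ : φ ∈ TestClass d r) (l : ℝ)
    (x : Fin d → ℝ) : Continuous (scaledTest φ l x) :=
  continuous_const.mul (hφ.1.continuous.comp (by fun_prop))

theorem abs_scaledTest_le {r : ℕ} {φ : (Fin d → ℝ) → ℝ} (hφ : φ ∈ TestClass d r) {l : ℝ}
    (hl : 0 < l) (x y : Fin d → ℝ) : |scaledTest φ l x y| ≤ (l ^ d)⁻¹ := by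
  have h := hφ.2.2 0 (Nat.zero_le r) Fin.elim0 (l⁻¹ • (y - x))
  rw [iteratedFDeriv_zero_apply] at h
  rw [scaledTest, abs_mul, abs_of_nonneg (by positivity)]
  exact mul_le_of_le_one_right (by positivity) h

theorem scaledTest_eq_zero {r : ℕ} {φ : (Fin d → ℝ) → ℝ} (hφ : φ ∈ TestClass d r) {l : ℝ}
    (hl : 0 < l) (x y : Fin d → ℝ) (hy : y ∉ Metric.closedBall x l) : scaledTest φ l x y = 0 := by
  have h : l⁻¹ • (y - x) ∉ tsupport φ := fun h => by
    have h1 := hφ.2.1 h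
    rw [mem_closedBall_zero_iff, norm_smul, norm_inv, Real.norm_of_nonneg hl.le,
      inv_mul_le_iff₀ hl, mul_one, ← dist_eq_norm] at h1
    exact hy h1
  rw [scaledTest, image_eq_zero_of_notMem_tsupport h, mul_zero]

/-- The bound on a kernel smeared with a test function of scale `l`, given its weak integral. -/
theorem norm_sq_le_of_isWeakIntegral_scaledTest (hd : 0 < d) {q : ℝ} {Z : Finset ℝ}
    (hZ : ∀ ζ ∈ Z, 0 ≤ ζ ∧ ζ < q + d) {V : (Fin d → ℝ) → KernelSpace d k}
    (hV : AEStronglyMeasurable V volume) {w : (Fin d → ℝ) → ℝ} {D l : ℝ} (hD : 0 ≤ D)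
    (hl : 0 < l) (hw0 : ∀ u, 0 ≤ w u) (hw : ∀ u, ‖u‖ ≤ l → w u ≤ l)
    (hVV : ∀ u u', u ≠ u' → |inner ℝ (V u) (V u')|
      ≤ D * ∑ ζ ∈ Z, (w u + w u') ^ ζ * ‖u - u'‖ ^ (q - ζ))
    {r : ℕ} {φ : (Fin d → ℝ) → ℝ} (hφ : φ ∈ TestClass d r) (x : Fin d → ℝ) {F : KernelSpace d k}
    (hF : IsWeakIntegral volume
      (fun y => scaledTest φ l x y • translateKernel x (V (y - x))) F) :
    ‖F‖ ^ 2 ≤ D * singularConst d q Z * l ^ q := by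
  obtain ⟨F', hF', hle⟩ := exists_isWeakIntegral_smeared hd hZ hV hD hl hw0 hw hVV
    (scaledTest_continuous hφ l x) x (by positivity) (abs_scaledTest_le hφ hl x)
    (scaledTest_eq_zero hφ hl x)
  rw [hF.unique hF']
  refine hle.trans_eq ?_
  have h : l ^ (2 * (d : ℝ) + q) = (l ^ d) ^ 2 * l ^ q := by
    rw [Real.rpow_add hl, ← pow_mul, ← Real.rpow_natCast]
    congr 2
    push_cast
    ring
  rw [h]
  field_simp

/-- The existence of the weak integral for an arbitrary test function; the radius of the support is
bounded below by one only to make it positive. -/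
theorem exists_isWeakIntegral_of_hasCompactSupport (hd : 0 < d) {q : ℝ} {Z : Finset ℝ}
    (hZ : ∀ ζ ∈ Z, 0 ≤ ζ ∧ ζ < q + d) {V : (Fin d → ℝ) → KernelSpace d k}
    (hV : AEStronglyMeasurable V volume) {D : ℝ} (hD : 0 ≤ D)
    (hVV : ∀ u u', u ≠ u' → |inner ℝ (V u) (V u')|
      ≤ D * ∑ ζ ∈ Z, (‖u‖ + ‖u'‖) ^ ζ * ‖u - u'‖ ^ (q - ζ))
    {φ : (Fin d → ℝ) → ℝ} (hφ : Continuous φ) (hφc : HasCompactSupport φ) (x : Fin d → ℝ) :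
    ∃ F, IsWeakIntegral volume (fun y => φ y • translateKernel x (V (y - x))) F := by
  obtain ⟨A, hA⟩ := hφ.bounded_above_of_compact_support hφc
  obtain ⟨R, hR⟩ := hφc.isCompact.isBounded.subset_closedBall x
  obtain ⟨F, hF, -⟩ := exists_isWeakIntegral_smeared (R := max R 1) (A := A) hd hZ hV hD
    (lt_max_of_lt_right one_pos) (fun u => norm_nonneg u) (fun u hu => hu) hVV hφ x
    ((norm_nonneg _).trans (hA 0)) hA fun y hy =>
      image_eq_zero_of_notMem_tsupport fun h =>
        hy (Metric.closedBall_subset_closedBall (le_max_left _ _) (hR h))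
  exact ⟨F, hF⟩

/-- Increments in time of a smeared kernel. Over times with `|t - s| ^ (1 / s₀) ≤ l` the bound on
increments applies; over longer times both terms are estimated separately, and `l ^ (2 * δ)` is
traded for `|t - s| ^ (2 * δ / s₀)`. -/
theorem norm_sub_sq_le_of_isWeakIntegral_scaledTest (hd : 0 < d) {s₀ : ℝ}
    {a δ : ℝ} (hδ : 0 < δ) {Z Z' : Finset ℝ} (hZ : ∀ ζ ∈ Z, 0 ≤ ζ ∧ ζ < 2 * a + d)
    (hZ' : ∀ ζ ∈ Z', 0 ≤ ζ ∧ ζ < 2 * (a - δ) + d)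
    {V : ℝ → (Fin d → ℝ) → KernelSpace d k} {C K e : ℝ} (hC : 0 ≤ C) (hK : 0 ≤ K) (he : 0 ≤ e)
    {t s : ℝ} (hVt : AEStronglyMeasurable (V t) volume) (hVs : AEStronglyMeasurable (V s) volume)
    (hVVt : ∀ u u', u ≠ u' → |inner ℝ (V t u) (V t u')|
      ≤ C * e * ∑ ζ ∈ Z, (‖u‖ + ‖u'‖) ^ ζ * ‖u - u'‖ ^ (2 * a - ζ))
    (hVVs : ∀ u u', u ≠ u' → |inner ℝ (V s u) (V s u')|
      ≤ C * e * ∑ ζ ∈ Z, (‖u‖ + ‖u'‖) ^ ζ * ‖u - u'‖ ^ (2 * a - ζ))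
    (hVVts : ∀ u u', u ≠ u' → |inner ℝ (V t u - V s u) (V t u' - V s u')|
      ≤ K * e * (∑ ζ ∈ Z', (scaledNorm s₀ (t - s) u + scaledNorm s₀ (t - s) u') ^ ζ
        * ‖u - u'‖ ^ (2 * (a - δ) - ζ)) * |t - s| ^ (2 * δ / s₀))
    {l : ℝ} (hl : 0 < l) {r : ℕ} {φ : (Fin d → ℝ) → ℝ} (hφ : φ ∈ TestClass d r)
    (x : Fin d → ℝ) {Ft Fs : KernelSpace d k}
    (hFt : IsWeakIntegral volume
      (fun y => scaledTest φ l x y • translateKernel x (V t (y - x))) Ft)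
    (hFs : IsWeakIntegral volume
      (fun y => scaledTest φ l x y • translateKernel x (V s (y - x))) Fs) :
    ‖Ft - Fs‖ ^ 2 ≤ (K * singularConst d (2 * (a - δ)) Z' + 4 * C * singularConst d (2 * a) Z)
      * e * l ^ (2 * (a - δ)) * |t - s| ^ (2 * δ / s₀) := by
  have hc := singularConst_nonneg d (2 * a) Z
  have hc' := singularConst_nonneg d (2 * (a - δ)) Z'
  have hts : 0 ≤ |t - s| ^ (2 * δ / s₀) := Real.rpow_nonneg (abs_nonneg _) _
  have hlp : 0 ≤ l ^ (2 * (a - δ)) := Real.rpow_nonneg hl.le _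
  rcases le_or_gt (|t - s| ^ (1 / s₀)) l with h | h
  · have hF : IsWeakIntegral volume (fun y => scaledTest φ l x y •
        translateKernel x ((fun u => V t u - V s u) (y - x))) (Ft - Fs) := by
      refine (hFt.sub hFs).congr (Filter.Eventually.of_forall fun y => ?_)
      simp only [translateKernel_eq, map_sub, smul_sub]
    have h1 := norm_sq_le_of_isWeakIntegral_scaledTest hd hZ' (hVt.sub hVs)
      (w := scaledNorm s₀ (t - s)) (D := K * e * |t - s| ^ (2 * δ / s₀)) (by positivity) hl
      (fun u => (norm_nonneg u).trans (le_max_right _ _)) (fun u hu => max_le h hu)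
      (fun u u' huu => (hVVts u u' huu).trans_eq (by ring)) hφ x hF
    refine h1.trans ?_
    have h2 : 0 ≤ 4 * C * singularConst d (2 * a) Z * e * l ^ (2 * (a - δ))
        * |t - s| ^ (2 * δ / s₀) := by positivity
    linarith
  · have h1 := norm_sq_le_of_isWeakIntegral_scaledTest hd hZ hVt (w := fun u => ‖u‖)
      (mul_nonneg hC he) hl (fun u => norm_nonneg u) (fun u hu => hu) hVVt hφ x hFt
    have h2 := norm_sq_le_of_isWeakIntegral_scaledTest hd hZ hVs (w := fun u => ‖u‖)
      (mul_nonneg hC he) hl (fun u => norm_nonneg u) (fun u hu => hu) hVVs hφ x hFs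
    have h3 : ‖Ft - Fs‖ ^ 2 ≤ 2 * ‖Ft‖ ^ 2 + 2 * ‖Fs‖ ^ 2 := by
      have := parallelogram_law_with_norm ℝ Ft Fs
      nlinarith [sq_nonneg ‖Ft + Fs‖]
    have h4 : l ^ (2 * a) ≤ l ^ (2 * (a - δ)) * |t - s| ^ (2 * δ / s₀) := by
      have h5 : l ^ (2 * δ) ≤ |t - s| ^ (2 * δ / s₀) := by
        have := Real.rpow_le_rpow hl.le h.le (by positivity : 0 ≤ 2 * δ)
        rwa [← Real.rpow_mul (abs_nonneg _), one_div_mul_eq_div] at this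
      have h6 : l ^ (2 * a) = l ^ (2 * (a - δ)) * l ^ (2 * δ) := by
        rw [← Real.rpow_add hl]
        congr 1
        ring
      rw [h6]
      exact mul_le_mul_of_nonneg_left h5 hlp
    have h7 : 4 * (C * e * singularConst d (2 * a) Z * l ^ (2 * a))
        ≤ 4 * (C * e * singularConst d (2 * a) Z
          * (l ^ (2 * (a - δ)) * |t - s| ^ (2 * δ / s₀))) := by gcongr
    have h8 : 0 ≤ K * singularConst d (2 * (a - δ)) Z' * e * l ^ (2 * (a - δ))
        * |t - s| ^ (2 * δ / s₀) := by positivity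
    linarith

end Smeared

/-! ### Second moments of the random distributions -/

theorem integral_abs_sq_eq_norm_sq {Ω : Type*} [MeasurableSpace Ω] {P : Measure Ω}
    (Y : Lp ℝ 2 P) : ∫ ω, |Y ω| ^ 2 ∂P = ‖Y‖ ^ 2 := by
  rw [← real_inner_self_eq_norm_sq, L2.inner_def]
  exact integral_congr_ae (Filter.Eventually.of_forall fun ω => by simp [sq])

theorem norm_sum_wienerLinearMap_sq_le {d : ℕ} {Ω : Type*} [MeasurableSpace Ω] {P : Measure Ω}
    {ξ : Lp ℝ 2 (volume : Measure (SpaceTime d)) → Ω → ℝ} (hξ : IsWhiteNoise P ξ) (m : ℕ)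
    (F : (k : ℕ) → KernelSpace d k) {M : ℝ} (hF : ∀ k ∈ Finset.Icc 1 m, ‖F k‖ ^ 2 ≤ M) :
    ‖∑ k ∈ Finset.Icc 1 m, wienerLinearMap hξ k (F k)‖ ^ 2
      ≤ (∑ k ∈ Finset.Icc 1 m, √k.factorial) ^ 2 * M := by
  rcases (Finset.Icc 1 m).eq_empty_or_nonempty with h | ⟨k₀, hk₀⟩
  · simp [h]
  have hM : 0 ≤ M := (sq_nonneg _).trans (hF k₀ hk₀)
  have h : ‖∑ k ∈ Finset.Icc 1 m, wienerLinearMap hξ k (F k)‖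
      ≤ (∑ k ∈ Finset.Icc 1 m, √k.factorial) * √M := by
    rw [Finset.sum_mul]
    refine norm_sum_le_of_le _ fun k hk => (norm_wienerLinearMap_le hξ (F k)).trans ?_
    exact mul_le_mul_of_nonneg_left (Real.le_sqrt_of_sq_le (hF k hk)) (Real.sqrt_nonneg _)
  calc ‖∑ k ∈ Finset.Icc 1 m, wienerLinearMap hξ k (F k)‖ ^ 2
      ≤ ((∑ k ∈ Finset.Icc 1 m, √k.factorial) * √M) ^ 2 :=
        pow_le_pow_left₀ (norm_nonneg _) h 2
    _ = _ := by rw [mul_pow, Real.sq_sqrt hM]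


end

theorem proposition3p3
    {Ω : Type*} [MeasurableSpace Ω] (P : Measure Ω) [IsProbabilityMeasure P]
    (d : ℕ) (hd : 0 < d) (s₀ : ℝ) (hs₀ : 0 < s₀)
    (ξ : Lp ℝ 2 (volume : Measure (SpaceTime d)) → Ω → ℝ) (hξ : IsWhiteNoise P ξ)
    -- `α` is the homogeneity of the symbol, `m` the number of its noises
    (α : ℝ) (m : ℕ)
    (J : Set ℝ) (r : ℕ) (hr : 0 < r)
    -- the kernels `W^{(k)}` and `W^{(k;ε)}`
    (W : (k : ℕ) → ℝ → (Fin d → ℝ) → KernelSpace d k)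
    (Wε : ℝ → (k : ℕ) → ℝ → (Fin d → ℝ) → KernelSpace d k)
    (hWm : ∀ k ∈ Finset.Icc 1 m, ∀ t ∈ J, AEStronglyMeasurable (W k t) volume)
    (hWεm : ∀ ε ∈ Set.Ioc (0 : ℝ) 1, ∀ k ∈ Finset.Icc 1 m, ∀ t ∈ J,
      AEStronglyMeasurable (Wε ε k t) volume)
    (ν ν' C : ℝ) (hν : 0 < ν) (hν' : 0 < ν') (hC : 0 < C) (hαν : -(d : ℝ) < 2 * (α + ν))
    (Z : Finset ℝ) (hZ : ∀ ζ ∈ Z, 0 ≤ ζ ∧ ζ < 2 * (α + ν) + d)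
    (hW : ∀ k ∈ Finset.Icc 1 m, ∀ t ∈ J, ∀ x x' : Fin d → ℝ, x ≠ x' →
      |inner ℝ (W k t x) (W k t x')| ≤
        C * ∑ ζ ∈ Z, (‖x‖ + ‖x'‖) ^ ζ * ‖x - x'‖ ^ (2 * (α + ν) - ζ))
    (hWε : ∀ ε ∈ Set.Ioc (0 : ℝ) 1, ∀ k ∈ Finset.Icc 1 m, ∀ t ∈ J,
      ∀ x x' : Fin d → ℝ, x ≠ x' →
      |inner ℝ (Wε ε k t x - W k t x) (Wε ε k t x' - W k t x')| ≤
        C * ε ^ ν' * ∑ ζ ∈ Z, (‖x‖ + ‖x'‖) ^ ζ * ‖x - x'‖ ^ (2 * (α + ν) - ζ)) :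
    -- the integrals in the definition of the random distributions exist
    (∀ k ∈ Finset.Icc 1 m, ∀ t ∈ J, ∀ x : Fin d → ℝ, ∀ φ : (Fin d → ℝ) → ℝ,
      Continuous φ → HasCompactSupport φ →
      (∃ F, IsWeakIntegral volume (smearedKernel (W k) t x φ) F) ∧
      ∀ ε ∈ Set.Ioc (0 : ℝ) 1, ∃ F, IsWeakIntegral volume (smearedKernel (Wε ε k) t x φ) F) ∧
    -- the bound on second moments
    (∃ C₁ : ℝ, ∀ t ∈ J, ∀ x : Fin d → ℝ, ∀ l ∈ Set.Ioc (0 : ℝ) 1, ∀ φ ∈ TestClass d r,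
      ∫ ω, |chaosModel P ξ m W t x (scaledTest φ l x) ω| ^ 2 ∂P ≤ C₁ * l ^ (2 * (α + ν))) ∧
    -- the bound on second moments of the differences
    (∃ C₂ : ℝ, ∀ ε ∈ Set.Ioc (0 : ℝ) 1, ∀ t ∈ J, ∀ x : Fin d → ℝ, ∀ l ∈ Set.Ioc (0 : ℝ) 1,
      ∀ φ ∈ TestClass d r,
      ∫ ω, |chaosModel P ξ m (Wε ε) t x (scaledTest φ l x) ω
          - chaosModel P ξ m W t x (scaledTest φ l x) ω| ^ 2 ∂P
        ≤ C₂ * ε ^ ν' * l ^ (2 * (α + ν))) ∧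
    -- the bounds on time increments
    (∀ (δ K : ℝ) (Z' : Finset ℝ), 0 < δ → δ < α + ν + d / 2 → 0 < K →
      (∀ ζ ∈ Z', 0 ≤ ζ ∧ ζ < 2 * (α + ν - δ) + d) →
      (∀ k ∈ Finset.Icc 1 m, ∀ t ∈ J, ∀ s ∈ J, ∀ x x' : Fin d → ℝ, x ≠ x' →
        |inner ℝ (W k t x - W k s x) (W k t x' - W k s x')| ≤
          K * (∑ ζ ∈ Z', (scaledNorm s₀ (t - s) x + scaledNorm s₀ (t - s) x') ^ ζ
            * ‖x - x'‖ ^ (2 * (α + ν - δ) - ζ)) * |t - s| ^ (2 * δ / s₀)) →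
      (∀ ε ∈ Set.Ioc (0 : ℝ) 1, ∀ k ∈ Finset.Icc 1 m, ∀ t ∈ J, ∀ s ∈ J,
        ∀ x x' : Fin d → ℝ, x ≠ x' →
        |inner ℝ ((Wε ε k t x - W k t x) - (Wε ε k s x - W k s x))
            ((Wε ε k t x' - W k t x') - (Wε ε k s x' - W k s x'))| ≤
          K * ε ^ ν' * (∑ ζ ∈ Z', (scaledNorm s₀ (t - s) x + scaledNorm s₀ (t - s) x') ^ ζ
            * ‖x - x'‖ ^ (2 * (α + ν - δ) - ζ)) * |t - s| ^ (2 * δ / s₀)) →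
      (∃ C₃ : ℝ, ∀ t ∈ J, ∀ s ∈ J, ∀ x : Fin d → ℝ, ∀ l ∈ Set.Ioc (0 : ℝ) 1,
        ∀ φ ∈ TestClass d r,
        ∫ ω, |chaosModel P ξ m W t x (scaledTest φ l x) ω
            - chaosModel P ξ m W s x (scaledTest φ l x) ω| ^ 2 ∂P
          ≤ C₃ * l ^ (2 * (α + ν - δ)) * |t - s| ^ (2 * δ / s₀)) ∧
      (∃ C₄ : ℝ, ∀ ε ∈ Set.Ioc (0 : ℝ) 1, ∀ t ∈ J, ∀ s ∈ J, ∀ x : Fin d → ℝ,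
        ∀ l ∈ Set.Ioc (0 : ℝ) 1, ∀ φ ∈ TestClass d r,
        ∫ ω, |chaosModel P ξ m (Wε ε) t x (scaledTest φ l x) ω
            - chaosModel P ξ m W t x (scaledTest φ l x) ω
            - chaosModel P ξ m (Wε ε) s x (scaledTest φ l x) ω
            + chaosModel P ξ m W s x (scaledTest φ l x) ω| ^ 2 ∂P
          ≤ C₄ * ε ^ ν' * l ^ (2 * (α + ν - δ)) * |t - s| ^ (2 * δ / s₀))) := by
  -- The differences `Wε - W` satisfy the same hypotheses as `W`, up to the factor `ε ^ ν'`, and the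
  -- integrals of `Wε` are obtained from those of `W` and of the differences.
  have hdm : ∀ ε ∈ Set.Ioc (0 : ℝ) 1, ∀ k ∈ Finset.Icc 1 m, ∀ t ∈ J,
      AEStronglyMeasurable (fun u => Wε ε k t u - W k t u) volume := fun ε hε k hk t ht =>
    (hWεm ε hε k hk t ht).sub (hWm k hk t ht)
  have hexW : ∀ k ∈ Finset.Icc 1 m, ∀ t ∈ J, ∀ x : Fin d → ℝ, ∀ φ : (Fin d → ℝ) → ℝ,
      Continuous φ → HasCompactSupport φ →
      ∃ F, IsWeakIntegral volume (smearedKernel (W k) t x φ) F :=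
    fun k hk t ht x φ hφ hφc =>
      exists_isWeakIntegral_of_hasCompactSupport hd hZ (hWm k hk t ht) hC.le (hW k hk t ht) hφ hφc x
  have hexWε : ∀ ε ∈ Set.Ioc (0 : ℝ) 1, ∀ k ∈ Finset.Icc 1 m, ∀ t ∈ J, ∀ x : Fin d → ℝ,
      ∀ φ : (Fin d → ℝ) → ℝ, Continuous φ → HasCompactSupport φ →
      ∃ F, IsWeakIntegral volume (smearedKernel (Wε ε k) t x φ) F := by
    intro ε hε k hk t ht x φ hφ hφc
    obtain ⟨F, hF⟩ := hexW k hk t ht x φ hφ hφc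
    obtain ⟨G, hG⟩ := exists_isWeakIntegral_of_hasCompactSupport hd hZ (hdm ε hε k hk t ht)
      (mul_nonneg hC.le (Real.rpow_nonneg hε.1.le _)) (hWε ε hε k hk t ht) hφ hφc x
    refine ⟨F + G, (hF.add hG).congr (Filter.Eventually.of_forall fun y => ?_)⟩
    simp only [smearedKernel, translateKernel_eq, ← smul_add, ← map_add, add_sub_cancel]
  have hcs : ∀ φ ∈ TestClass d r, ∀ l ∈ Set.Ioc (0 : ℝ) 1, ∀ x : Fin d → ℝ,
      HasCompactSupport (scaledTest φ l x) := fun φ hφ l hl x =>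
    HasCompactSupport.intro (isCompact_closedBall x l) (scaledTest_eq_zero hφ hl.1 x)
  have hwW : ∀ k ∈ Finset.Icc 1 m, ∀ t ∈ J, ∀ x : Fin d → ℝ, ∀ l ∈ Set.Ioc (0 : ℝ) 1,
      ∀ φ ∈ TestClass d r, IsWeakIntegral volume (smearedKernel (W k) t x (scaledTest φ l x))
        (weakIntegral volume (smearedKernel (W k) t x (scaledTest φ l x))) := by
    intro k hk t ht x l hl φ hφ
    obtain ⟨F, hF⟩ := hexW k hk t ht x _ (scaledTest_continuous hφ l x) (hcs φ hφ l hl x)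
    rwa [hF.weakIntegral_eq]
  have hwd : ∀ ε ∈ Set.Ioc (0 : ℝ) 1, ∀ k ∈ Finset.Icc 1 m, ∀ t ∈ J, ∀ x : Fin d → ℝ,
      ∀ l ∈ Set.Ioc (0 : ℝ) 1, ∀ φ ∈ TestClass d r,
      IsWeakIntegral volume (fun y => scaledTest φ l x y •
          translateKernel x ((fun u => Wε ε k t u - W k t u) (y - x)))
        (weakIntegral volume (smearedKernel (Wε ε k) t x (scaledTest φ l x))
          - weakIntegral volume (smearedKernel (W k) t x (scaledTest φ l x))) := by
    intro ε hε k hk t ht x l hl φ hφ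
    obtain ⟨F, hF⟩ := hexWε ε hε k hk t ht x _ (scaledTest_continuous hφ l x) (hcs φ hφ l hl x)
    rw [hF.weakIntegral_eq]
    refine (hF.sub (hwW k hk t ht x l hl φ hφ)).congr (Filter.Eventually.of_forall fun y => ?_)
    simp only [smearedKernel, translateKernel_eq, map_sub, smul_sub]
  have hchaos : ∀ (V : (k : ℕ) → ℝ → (Fin d → ℝ) → KernelSpace d k) t x φ,
      chaosModel P ξ m V t x φ = ∑ k ∈ Finset.Icc 1 m,
        wienerLinearMap hξ k (weakIntegral volume (smearedKernel (V k) t x φ)) :=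
    fun _ _ _ _ => rfl
  set S := (∑ k ∈ Finset.Icc 1 m, √k.factorial) ^ 2 with hS
  refine ⟨fun k hk t ht x φ hφ hφc => ⟨hexW k hk t ht x φ hφ hφc,
    fun ε hε => hexWε ε hε k hk t ht x φ hφ hφc⟩, ?_, ?_, ?_⟩
  · refine ⟨S * (C * singularConst d (2 * (α + ν)) Z), fun t ht x l hl φ hφ => ?_⟩
    rw [integral_abs_sq_eq_norm_sq, hchaos, mul_assoc]
    refine norm_sum_wienerLinearMap_sq_le hξ m _ fun k hk => ?_
    exact norm_sq_le_of_isWeakIntegral_scaledTest hd hZ (hWm k hk t ht) hC.le hl.1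
      (fun u => norm_nonneg u) (fun u hu => hu) (hW k hk t ht) hφ x (hwW k hk t ht x l hl φ hφ)
  · refine ⟨S * (C * singularConst d (2 * (α + ν)) Z), fun ε hε t ht x l hl φ hφ => ?_⟩
    rw [integral_congr_ae (g := fun ω => |(chaosModel P ξ m (Wε ε) t x (scaledTest φ l x)
      - chaosModel P ξ m W t x (scaledTest φ l x)) ω| ^ 2), integral_abs_sq_eq_norm_sq, hchaos,
      hchaos, ← Finset.sum_sub_distrib]
    · simp_rw [← map_sub]
      refine (norm_sum_wienerLinearMap_sq_le hξ m _ fun k hk =>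
        norm_sq_le_of_isWeakIntegral_scaledTest hd hZ (hdm ε hε k hk t ht)
          (mul_nonneg hC.le (Real.rpow_nonneg hε.1.le _)) hl.1
          (fun u => norm_nonneg u) (fun u hu => hu) (hWε ε hε k hk t ht) hφ x
          (hwd ε hε k hk t ht x l hl φ hφ)).trans_eq ?_
      rw [hS]
      ring
    · filter_upwards [Lp.coeFn_sub (chaosModel P ξ m (Wε ε) t x (scaledTest φ l x))
        (chaosModel P ξ m W t x (scaledTest φ l x))] with ω h1
      rw [h1, Pi.sub_apply]
  · intro δ K Z' hδ _ hK hZ' hWi hWεi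
    set κ := K * singularConst d (2 * (α + ν - δ)) Z'
      + 4 * C * singularConst d (2 * (α + ν)) Z with hκ
    refine ⟨⟨S * κ, fun t ht s hs x l hl φ hφ => ?_⟩,
      ⟨S * κ, fun ε hε t ht s hs x l hl φ hφ => ?_⟩⟩
    · rw [integral_congr_ae (g := fun ω => |(chaosModel P ξ m W t x (scaledTest φ l x)
        - chaosModel P ξ m W s x (scaledTest φ l x)) ω| ^ 2), integral_abs_sq_eq_norm_sq, hchaos,
        hchaos, ← Finset.sum_sub_distrib]
      · simp_rw [← map_sub]
        refine (norm_sum_wienerLinearMap_sq_le hξ m _ fun k hk =>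
          norm_sub_sq_le_of_isWeakIntegral_scaledTest (V := W k) (e := 1) hd hδ hZ hZ'
            hC.le hK.le zero_le_one (hWm k hk t ht) (hWm k hk s hs)
            (by simpa only [mul_one] using hW k hk t ht)
            (by simpa only [mul_one] using hW k hk s hs)
            (by simpa only [mul_one] using hWi k hk t ht s hs) hl.1 hφ x
            (hwW k hk t ht x l hl φ hφ) (hwW k hk s hs x l hl φ hφ)).trans_eq ?_
        rw [hS, hκ]
        ring
      · filter_upwards [Lp.coeFn_sub (chaosModel P ξ m W t x (scaledTest φ l x))
          (chaosModel P ξ m W s x (scaledTest φ l x))] with ω h1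
        rw [h1, Pi.sub_apply]
    · rw [integral_congr_ae (g := fun ω => |((chaosModel P ξ m (Wε ε) t x (scaledTest φ l x)
        - chaosModel P ξ m W t x (scaledTest φ l x))
        - (chaosModel P ξ m (Wε ε) s x (scaledTest φ l x)
        - chaosModel P ξ m W s x (scaledTest φ l x))) ω| ^ 2), integral_abs_sq_eq_norm_sq]
      · simp only [hchaos, ← Finset.sum_sub_distrib, ← map_sub]
        refine (norm_sum_wienerLinearMap_sq_le hξ m _ fun k hk =>
          norm_sub_sq_le_of_isWeakIntegral_scaledTest
            (V := fun t u => Wε ε k t u - W k t u) (e := ε ^ ν') hd hδ hZ hZ'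
            hC.le hK.le (Real.rpow_nonneg hε.1.le _) (hdm ε hε k hk t ht) (hdm ε hε k hk s hs)
            (hWε ε hε k hk t ht) (hWε ε hε k hk s hs)
            (hWεi ε hε k hk t ht s hs) hl.1 hφ x
            (hwd ε hε k hk t ht x l hl φ hφ) (hwd ε hε k hk s hs x l hl φ hφ)).trans_eq ?_
        rw [hS, hκ]
        ring
      · filter_upwards [Lp.coeFn_sub (chaosModel P ξ m (Wε ε) t x (scaledTest φ l x)
            - chaosModel P ξ m W t x (scaledTest φ l x))
            (chaosModel P ξ m (Wε ε) s x (scaledTest φ l x)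
            - chaosModel P ξ m W s x (scaledTest φ l x)),
          Lp.coeFn_sub (chaosModel P ξ m (Wε ε) t x (scaledTest φ l x))
            (chaosModel P ξ m W t x (scaledTest φ l x)),
          Lp.coeFn_sub (chaosModel P ξ m (Wε ε) s x (scaledTest φ l x))
            (chaosModel P ξ m W s x (scaledTest φ l x))] with ω h1 h2 h3
        rw [h1, Pi.sub_apply, h2, h3, Pi.sub_apply, Pi.sub_apply, ← sub_add]
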